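/- All graphs are finite and simple. For graphs $X,Y$, the lexicographic product $X[Y]$ is the graph on $V(X)\times V(Y)$ in which $(x,y)$ and $(x',y')$ are adjacent iff $xx'\in E(X)$, or $x=x'$ and $yy'\in E(Y)$. A quantum permutation group acting on a finite set $I$ is given by a pair $\mathbb G=(C(\mathbb G),u)$, where $C(\mathbb G)$ is a unital $C^*$-algebra generated by the entries of a magic unitary $u=[u_{ij}]_{i,j\in I}$ (the comultiplication being determined by $\Delta(u_{ij})=\sum_k u_{ik}\otimes u_{kj}$); two such pairs $(C(\mathbb G),u)$ and $(C(\mathbb H),v)$ are equal if $u_{ij}\mapsto v_{ij}$ defines a $*$-isomorphism $C(\mathbb G)\to C(\mathbb H)$. $\mathbb S_n^+$ is given by the universal unital $C^*$-algebra generated by the entries of an $n\times n$ magic unitary, and $\mathrm{Qut}(X)$ by the universal unital $C^*$-algebra generated by the entries of a magic unitary $[u_{ij}]_{i,j\in V(X)}$ such that $u_{ij}u_{k\ell}=0$ whenever exactly one of $ik\in E(X)$, $j\ell\in E(X)$ holds. For quantum permutation groups $\mathbb G=(C(\mathbb G),[u_{ij}]_{i,j\in M})$ and $\mathbb H=(C(\mathbb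 H),[v_{ab}]_{a,b\in N})$, the free wreath product $\mathbb G\wr_*\mathbb H$ is given by the quotient of the unital free product of $C(\mathbb H)$ and of copies of $C(\mathbb G)$ indexed by $a\in N$ (with generators $u^{(a)}_{ij}$) by the relations $u^{(a)}_{ij}v_{ab}=v_{ab}u^{(a)}_{ij}$, with the magic unitary $w_{(a,i)(b,j)}=u^{(a)}_{ij}v_{ab}$ indexed by $N\times M$. **Theorem.** Let $X$ and $Y$ be vertex-transitive graphs, with $Y$ nonempty, such that $\mathrm{Qut}(X[Y])\neq \mathrm{Qut}(Y)\wr_*\mathrm{Qut}(X)$. Then there exist integers $\alpha,\beta>1$ and vertex-transitive graphs $X',Y'$ such that either (a) $X\cong X'[\overline{K_\alpha}]$ and $Y\cong\overline{K_\beta}[Y']$, or (b) $X\cong X'[K_\alpha]$ and $Y\cong K_\beta[Y']$. Moreover, if $\alpha,\beta>1$ and vertex-transitive $X',Y'$ are such that (a) holds, with $\alpha$ and $\beta$ the largest integers that occur in such factorizations of $X$ and of $Y$ with vertex-transitive factors, or such that (b) holds, with $\alpha$ and $\beta$ the largest integers in the same sense for (b), then $$\mathrm{Qut}(X[Y])=(\mathrm{Qut}(Y')\wr_*\mathbb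 S^+_{\alpha\beta})\wr_*\mathrm{Qut}(X').$$ Here the vertex set of $X[Y]$ is identified with $V(X')\times([\alpha\beta]\times V(Y'))$ through any isomorphisms as in (a), respectively (b), and the standard bijection $[\alpha]\times[\beta]\cong[\alpha\beta]$. -/

import Mathlib

universe u v w x

noncomputable section

namespace QuantumAut

/-! ### Graphs -/

/-- The lexicographic product `X[Y]`. -/
def lex {V : Type u} {W : Type v} (X : SimpleGraph V) (Y : SimpleGraph W) :
    SimpleGraph (V × W) where
  Adj p q := X.Adj p.1 q.1 ∨ (p.1 = q.1 ∧ Y.Adj p.2 q.2)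
  symm := ⟨by
    rintro p q (h | ⟨h, h'⟩)
    · exact Or.inl h.symm
    · exact Or.inr ⟨h.symm, h'.symm⟩⟩
  loopless := ⟨by
    rintro p (h | ⟨_, h⟩)
    · exact X.loopless.irrefl _ h
    · exact Y.loopless.irrefl _ h⟩

/-- Every vertex can be moved to every other vertex by an automorphism. -/
def IsVertexTransitive {V : Type u} (X : SimpleGraph V) : Prop :=
  ∀ p q : V, ∃ f : X ≃g X, f p = q

/-- The complete graph `K_n`. -/
abbrev completeG (n : ℕ) : SimpleGraph (Fin n) := ⊤

/-- The edgeless graph on `n` vertices, i.e. the complement of `K_n`. -/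
abbrev edgelessG (n : ℕ) : SimpleGraph (Fin n) := ⊥

/-! ### The free unital `*`-algebra -/

/-- The free unital complex `*`-algebra on a set `G` of generators: noncommutative polynomials in
the letters `inl g` (standing for `g`) and `inr g` (standing for `g*`). -/
def FreeStarAlg (G : Type u) : Type u := FreeAlgebra ℂ (G ⊕ G)

namespace FreeStarAlg

variable (G : Type u)

instance : Ring (FreeStarAlg G) := inferInstanceAs (Ring (FreeAlgebra ℂ (G ⊕ G)))
instance : Algebra ℂ (FreeStarAlg G) := inferInstanceAs (Algebra ℂ (FreeAlgebra ℂ (G ⊕ G)))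

/-- The opposite of the free algebra, with complex conjugate scalars. It only serves to define the
involution below. -/
def ConjOp : Type u := (FreeStarAlg G)ᵐᵒᵖ

instance : Ring (ConjOp G) := inferInstanceAs (Ring (FreeStarAlg G)ᵐᵒᵖ)

instance : Algebra ℂ (ConjOp G) :=
  RingHom.toAlgebra' ((algebraMap ℂ (FreeStarAlg G)ᵐᵒᵖ).comp (starRingEnd ℂ))
    (fun c a => Algebra.commutes (A := (FreeStarAlg G)ᵐᵒᵖ) (starRingEnd ℂ c) a)

/-- The letter `inl g` or `inr g`. -/
def letter {G : Type u} (s : G ⊕ G) : FreeStarAlg G := FreeAlgebra.ι ℂ s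

/-- The involution, as a conjugate linear anti-homomorphism exchanging `inl g` and `inr g`. -/
def starAux : FreeStarAlg G →ₐ[ℂ] ConjOp G :=
  FreeAlgebra.lift ℂ (fun s : G ⊕ G => (MulOpposite.op (letter s.swap) : (FreeStarAlg G)ᵐᵒᵖ))

variable {G}

instance : Star (FreeStarAlg G) where
  star a := MulOpposite.unop (starAux G a : (FreeStarAlg G)ᵐᵒᵖ)

theorem star_letter (s : G ⊕ G) : star (letter s) = letter s.swap := by
  exact congrArg MulOpposite.unop (FreeAlgebra.lift_ι_apply
    (A := ConjOp G) (fun s : G ⊕ G => (MulOpposite.op (letter s.swap) : (FreeStarAlg G)ᵐᵒᵖ)) s)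

theorem star_algebraMap (c : ℂ) :
    star (algebraMap ℂ (FreeStarAlg G) c) = algebraMap ℂ (FreeStarAlg G) (star c) := by
  change MulOpposite.unop (starAux G (algebraMap ℂ _ c) : (FreeStarAlg G)ᵐᵒᵖ) = _
  rw [AlgHom.commutes]
  rfl

theorem star_add' (a b : FreeStarAlg G) : star (a + b) = star a + star b := by
  change MulOpposite.unop (starAux G (a + b) : (FreeStarAlg G)ᵐᵒᵖ) = _
  rw [map_add]
  rfl

theorem star_mul' (a b : FreeStarAlg G) : star (a * b) = star b * star a := by
  change MulOpposite.unop (starAux G (a * b) : (FreeStarAlg G)ᵐᵒᵖ) = _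
  rw [map_mul]
  rfl

/-- Induction over noncommutative polynomials. -/
theorem induction {C : FreeStarAlg G → Prop} (hc : ∀ c, C (algebraMap ℂ _ c))
    (hl : ∀ s, C (letter s)) (hm : ∀ a b, C a → C b → C (a * b))
    (ha : ∀ a b, C a → C b → C (a + b)) (a : FreeStarAlg G) : C a :=
  FreeAlgebra.induction (R := ℂ) (X := G ⊕ G) (motive := C) hc hl hm ha a

theorem star_star' (a : FreeStarAlg G) : star (star a) = a := by
  induction a using induction with
  | hc c => rw [star_algebraMap, star_algebraMap, star_star]
  | hl s => rw [star_letter, star_letter, Sum.swap_swap]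
  | hm a b ha hb => rw [star_mul', star_mul', ha, hb]
  | ha a b ha hb => rw [star_add', star_add', ha, hb]

instance : StarRing (FreeStarAlg G) where
  star_involutive := star_star'
  star_mul := star_mul'
  star_add := star_add'

instance : StarModule ℂ (FreeStarAlg G) where
  star_smul c a := by
    rw [Algebra.smul_def, star_mul', star_algebraMap, Algebra.smul_def, Algebra.commutes]

/-- The generator `g`. -/
def gen (g : G) : FreeStarAlg G := letter (Sum.inl g)

end FreeStarAlg

/-! ### Universal unital `C*`-algebras -/

/-- A presentation of a unital `C*`-algebra on a set `G` of generators: a set of `*`-polynomials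
(the relations, each of which is required to vanish), and an upper bound for the norm of each
generator. The bounds make sure that the universal `C*`-algebra exists. -/
structure Presentation (G : Type u) where
  rels : Set (FreeStarAlg G)
  bound : G → ℝ

/-- A `C*`-seminorm on the free `*`-algebra that is compatible with the presentation, that is, one
that kills the relations and respects the bounds. These are the seminorms `a ↦ ‖π a‖` where `π` is
a representation of the presentation by elements of a unital `C*`-algebra. -/
structure Presentation.CStarSeminorm {G : Type u} (P : Presentation G) extends
    Seminorm ℂ (FreeStarAlg G) where
  mul_le' : ∀ a b, toFun (a * b) ≤ toFun a * toFun b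
  star_mul_self' : ∀ a, toFun (star a * a) = toFun a * toFun a
  rel' : ∀ r ∈ P.rels, toFun r = 0
  bound' : ∀ g, toFun (FreeStarAlg.gen g) ≤ P.bound g

namespace Presentation

open FreeStarAlg

variable {G : Type u} {P : Presentation G}

namespace CStarSeminorm

variable (p : P.CStarSeminorm)

theorem nonneg (a : FreeStarAlg G) : 0 ≤ p.toFun a := apply_nonneg p.toSeminorm a

theorem one_le : p.toFun 1 ≤ 1 := by
  have h := p.star_mul_self' 1
  rw [star_one, one_mul] at h
  nlinarith [p.nonneg 1]

theorem star_le (a : FreeStarAlg G) : p.toFun a ≤ p.toFun (star a) := by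
  have h := p.star_mul_self' a
  have h' := p.mul_le' (star a) a
  rcases (p.nonneg a).eq_or_lt with h0 | h0
  · rw [← h0]; exact p.nonneg _
  · nlinarith

theorem star_eq (a : FreeStarAlg G) : p.toFun (star a) = p.toFun a := by
  refine le_antisymm ?_ (p.star_le a)
  have h := p.star_le (star a)
  rwa [star_star] at h

theorem smul_eq (c : ℂ) (a : FreeStarAlg G) : p.toFun (c • a) = ‖c‖ * p.toFun a :=
  p.smul' c a

end CStarSeminorm

theorem exists_bound (P : Presentation G) (a : FreeStarAlg G) :
    ∃ C : ℝ, ∀ p : P.CStarSeminorm, p.toFun a ≤ C := by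
  induction a using FreeStarAlg.induction with
  | hc c =>
    refine ⟨‖c‖ * 1, fun p => ?_⟩
    rw [Algebra.algebraMap_eq_smul_one, p.smul_eq]
    exact mul_le_mul_of_nonneg_left p.one_le (norm_nonneg c)
  | hl s =>
    rcases s with g | g
    · exact ⟨P.bound g, fun p => p.bound' g⟩
    · refine ⟨P.bound g, fun p => ?_⟩
      have h : letter (Sum.inr g) = star (gen g) := (star_letter (Sum.inl g)).symm
      rw [h, p.star_eq]
      exact p.bound' g
  | hm a b ha hb =>
    obtain ⟨C, hC⟩ := ha
    obtain ⟨D, hD⟩ := hb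
    exact ⟨C * D, fun p => (p.mul_le' a b).trans
      (mul_le_mul (hC p) (hD p) (p.nonneg b) ((p.nonneg a).trans (hC p)))⟩
  | ha a b ha hb =>
    obtain ⟨C, hC⟩ := ha
    obtain ⟨D, hD⟩ := hb
    exact ⟨C + D, fun p => (p.add_le' a b).trans (add_le_add (hC p) (hD p))⟩

/-- The universal seminorm of a presentation: the supremum of `‖π a‖` over all representations. -/
def univNorm (P : Presentation G) (a : FreeStarAlg G) : ℝ :=
  ⨆ p : P.CStarSeminorm, p.toFun a

theorem le_univNorm (p : P.CStarSeminorm) (a : FreeStarAlg G) : p.toFun a ≤ P.univNorm a := by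
  obtain ⟨C, hC⟩ := P.exists_bound a
  exact le_ciSup (f := fun p : P.CStarSeminorm => p.toFun a)
    ⟨C, by rintro _ ⟨q, rfl⟩; exact hC q⟩ p

theorem univNorm_nonneg (a : FreeStarAlg G) : 0 ≤ P.univNorm a :=
  Real.iSup_nonneg fun p => p.nonneg a

theorem univNorm_le {a : FreeStarAlg G} {C : ℝ} (hC : 0 ≤ C)
    (h : ∀ p : P.CStarSeminorm, p.toFun a ≤ C) : P.univNorm a ≤ C :=
  Real.iSup_le h hC

/-- The universal seminorm as a ring seminorm. -/
def univSeminorm (P : Presentation G) : RingSeminorm (FreeStarAlg G) where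
  toFun := P.univNorm
  map_zero' := le_antisymm
    (univNorm_le le_rfl fun p => (map_zero p.toSeminorm).le) (univNorm_nonneg 0)
  add_le' a b := univNorm_le (add_nonneg (univNorm_nonneg a) (univNorm_nonneg b)) fun p =>
    (p.add_le' a b).trans (add_le_add (le_univNorm p a) (le_univNorm p b))
  neg' a := by
    refine congrArg iSup (funext fun p => ?_)
    exact p.neg' a
  mul_le' a b := univNorm_le (mul_nonneg (univNorm_nonneg a) (univNorm_nonneg b)) fun p =>
    (p.mul_le' a b).trans
      (mul_le_mul (le_univNorm p a) (le_univNorm p b) (p.nonneg b) (univNorm_nonneg a))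

theorem univNorm_smul (c : ℂ) (a : FreeStarAlg G) :
    P.univNorm (c • a) = ‖c‖ * P.univNorm a := by
  rw [univNorm, univNorm, Real.mul_iSup_of_nonneg (norm_nonneg c)]
  exact congrArg iSup (funext fun p => p.smul_eq c a)

theorem univNorm_star (a : FreeStarAlg G) : P.univNorm (star a) = P.univNorm a :=
  congrArg iSup (funext fun p => p.star_eq a)

theorem univNorm_star_mul_self (a : FreeStarAlg G) :
    P.univNorm a * P.univNorm a ≤ P.univNorm (star a * a) := by
  have h : P.univNorm a ≤ Real.sqrt (P.univNorm (star a * a)) := by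
    refine univNorm_le (Real.sqrt_nonneg _) fun p => Real.le_sqrt_of_sq_le ?_
    rw [sq, ← p.star_mul_self' a]
    exact le_univNorm p _
  have h' := mul_le_mul h h (univNorm_nonneg a) (Real.sqrt_nonneg _)
  rwa [Real.mul_self_sqrt (univNorm_nonneg _)] at h'

/-- The free `*`-algebra, endowed with the universal seminorm of the presentation `P`. -/
def Pre (_P : Presentation G) : Type u := FreeStarAlg G

/-- The identity map. -/
def toPre (P : Presentation G) (a : FreeStarAlg G) : P.Pre := a

instance : SeminormedRing P.Pre := P.univSeminorm.toSeminormedRing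
instance : Algebra ℂ P.Pre := inferInstanceAs (Algebra ℂ (FreeStarAlg G))
instance : StarRing P.Pre := inferInstanceAs (StarRing (FreeStarAlg G))
instance : StarModule ℂ P.Pre := inferInstanceAs (StarModule ℂ (FreeStarAlg G))
instance : NormedAlgebra ℂ P.Pre where
  norm_smul_le c a := (univNorm_smul (P := P) c a).le
instance : NormedStarGroup P.Pre where
  norm_star_le a := (univNorm_star (P := P) a).le

/-- The universal unital `C*`-algebra of the presentation `P`: the (separated) completion of the
free `*`-algebra with respect to the universal seminorm. -/
def CStar (P : Presentation G) : Type u := UniformSpace.Completion P.Pre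

open UniformSpace

instance : NormedRing P.CStar := inferInstanceAs (NormedRing (Completion P.Pre))
instance : CompleteSpace P.CStar := inferInstanceAs (CompleteSpace (Completion P.Pre))
instance : Algebra ℂ P.CStar := inferInstanceAs (Algebra ℂ (Completion P.Pre))
instance : NormedAlgebra ℂ P.CStar where
  norm_smul_le c a := norm_smul_le (α := ℂ) (β := Completion P.Pre) c a

/-- The canonical map from the free `*`-algebra. -/
def ofFree (P : Presentation G) (a : FreeStarAlg G) : P.CStar :=
  ((P.toPre a : P.Pre) : Completion P.Pre)

instance : Star P.CStar where
  star := Completion.map (star : P.Pre → P.Pre)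

theorem uniformContinuous_star_pre : UniformContinuous (star : P.Pre → P.Pre) :=
  (starₗᵢ ℂ (E := P.Pre)).isometry.uniformContinuous

theorem continuous_star_cstar : Continuous (star : P.CStar → P.CStar) :=
  Completion.continuous_map

theorem ofFree_star (a : FreeStarAlg G) : P.ofFree (star a) = star (P.ofFree a) :=
  (Completion.map_coe uniformContinuous_star_pre (P.toPre a)).symm

theorem ofFree_add (a b : FreeStarAlg G) : P.ofFree (a + b) = P.ofFree a + P.ofFree b :=
  Completion.coe_add (P.toPre a) (P.toPre b)

theorem ofFree_sub (a b : FreeStarAlg G) : P.ofFree (a - b) = P.ofFree a - P.ofFree b :=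
  Completion.coe_sub (P.toPre a) (P.toPre b)

theorem ofFree_mul (a b : FreeStarAlg G) : P.ofFree (a * b) = P.ofFree a * P.ofFree b :=
  Completion.coe_mul (P.toPre a) (P.toPre b)

theorem ofFree_one : P.ofFree 1 = 1 := Completion.coe_one P.Pre

theorem ofFree_zero : P.ofFree 0 = 0 := Completion.coe_zero

theorem ofFree_smul (c : ℂ) (a : FreeStarAlg G) : P.ofFree (c • a) = c • P.ofFree a :=
  Completion.coe_smul c (P.toPre a)

theorem norm_ofFree (a : FreeStarAlg G) : ‖P.ofFree a‖ = P.univNorm a :=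
  Completion.norm_coe (P.toPre a)

theorem denseRange_ofFree : DenseRange P.ofFree := Completion.denseRange_coe (α := P.Pre)

theorem cstar_induction {C : P.CStar → Prop} (hC : IsClosed {x | C x}) (h : ∀ a, C (P.ofFree a))
    (x : P.CStar) : C x :=
  Completion.induction_on (p := C) x hC h

theorem cstar_induction₂ {C : P.CStar → P.CStar → Prop}
    (hC : IsClosed {x : P.CStar × P.CStar | C x.1 x.2}) (h : ∀ a b, C (P.ofFree a) (P.ofFree b))
    (x y : P.CStar) : C x y :=
  Completion.induction_on₂ (p := C) x y hC h

instance : ContinuousStar P.CStar := ⟨continuous_star_cstar⟩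

instance : StarRing P.CStar where
  star_involutive x := by
    induction x using cstar_induction with
    | hC =>
      exact isClosed_eq
        (continuous_star_cstar.comp continuous_star_cstar) continuous_id
    | h a => rw [← ofFree_star, ← ofFree_star, star_star]
  star_mul x y := by
    induction x, y using cstar_induction₂ with
    | hC =>
      exact isClosed_eq
        (continuous_star_cstar.comp (continuous_fst.mul continuous_snd))
        ((continuous_star_cstar.comp continuous_snd).mul
          (continuous_star_cstar.comp continuous_fst))
    | h a b => rw [← ofFree_mul, ← ofFree_star, ← ofFree_star, ← ofFree_star, ← ofFree_mul, star_mul]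
  star_add x y := by
    induction x, y using cstar_induction₂ with
    | hC =>
      exact isClosed_eq
        (continuous_star_cstar.comp (continuous_fst.add continuous_snd))
        ((continuous_star_cstar.comp continuous_fst).add
          (continuous_star_cstar.comp continuous_snd))
    | h a b => rw [← ofFree_add, ← ofFree_star, ← ofFree_star, ← ofFree_star, ← ofFree_add, star_add]

instance : StarModule ℂ P.CStar where
  star_smul c x := by
    induction x using cstar_induction with
    | hC =>
      exact isClosed_eq
        (continuous_star_cstar.comp (continuous_const_smul c))
        (continuous_star_cstar.const_smul (star c))
    | h a => rw [← ofFree_smul, ← ofFree_star, ← ofFree_star, star_smul, ofFree_smul]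

instance : CStarRing P.CStar where
  norm_mul_self_le x := by
    induction x using cstar_induction with
    | hC =>
      exact isClosed_le (continuous_norm.mul continuous_norm)
        (continuous_norm.comp (continuous_star_cstar.mul continuous_id))
    | h a =>
      rw [← ofFree_star, ← ofFree_mul, norm_ofFree, norm_ofFree]
      exact univNorm_star_mul_self a

instance : CStarAlgebra P.CStar where

theorem ofFree_rel {r : FreeStarAlg G} (hr : r ∈ P.rels) : P.ofFree r = 0 := by
  rw [← norm_eq_zero, norm_ofFree]
  exact le_antisymm (univNorm_le le_rfl fun p => (p.rel' r hr).le) (univNorm_nonneg r)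

theorem ofFree_eq {a b : FreeStarAlg G} (h : a - b ∈ P.rels) : P.ofFree a = P.ofFree b := by
  rw [← sub_eq_zero, ← ofFree_sub, ofFree_rel h]

/-- The canonical map, as a unital `*`-homomorphism. -/
def ofFreeHom (P : Presentation G) : FreeStarAlg G →⋆ₐ[ℂ] P.CStar where
  toFun := P.ofFree
  map_one' := ofFree_one
  map_mul' := ofFree_mul
  map_zero' := ofFree_zero
  map_add' := ofFree_add
  commutes' c := by
    rw [Algebra.algebraMap_eq_smul_one, ofFree_smul, ofFree_one, Algebra.algebraMap_eq_smul_one]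
  map_star' := ofFree_star

/-- The universal `C*`-algebra is generated by the generators. -/
theorem generated (P : Presentation G) (S : StarSubalgebra ℂ P.CStar)
    (hS : IsClosed (S : Set P.CStar)) (h : ∀ g, P.ofFree (gen g) ∈ S) : S = ⊤ := by
  rw [eq_top_iff]
  intro x hx
  clear hx
  induction x using cstar_induction with
  | hC => exact hS
  | h a =>
    induction a using FreeStarAlg.induction with
    | hc c =>
      rw [Algebra.algebraMap_eq_smul_one, ofFree_smul, ofFree_one]
      exact S.smul_mem (one_mem S) c
    | hl s =>
      rcases s with g | g
      · exact h g
      · have h' : letter (Sum.inr g) = star (gen g) := (star_letter (Sum.inl g)).symm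
        rw [h', ofFree_star]
        exact star_mem (h g)
    | hm a b ha hb => rw [ofFree_mul]; exact mul_mem ha hb
    | ha a b ha hb => rw [ofFree_add]; exact add_mem ha hb

end Presentation

/-! ### Quantum permutation groups -/

/-- A magic unitary: the entries are self-adjoint idempotents, and each row and each column sums
to `1`. -/
structure IsMagicUnitary {I : Type v} [Fintype I] {A : Type u} [Ring A] [Star A]
    (e : I → I → A) : Prop where
  idem : ∀ i j, e i j * e i j = e i j
  selfAdj : ∀ i j, star (e i j) = e i j
  row_sum : ∀ i, ∑ k, e i k = 1
  col_sum : ∀ j, ∑ k, e k j = 1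

/-- A quantum permutation group acting on a finite set `I`, as a pair `(C(𝔾), e)` of a unital
`C*`-algebra and a magic unitary `e` indexed by `I` whose entries generate it. The comultiplication
is not listed: since the entries generate, it is determined by the pair, through the formula
`Δ (e i j) = ∑ k, e i k ⊗ e k j`. The set acted upon is meant to be nonempty; for empty `I` there
is no condition on generation. -/
structure QPG (I : Type v) [Fintype I] where
  carrier : Type u
  [inst : CStarAlgebra carrier]
  e : I → I → carrier
  magic : IsMagicUnitary e
  generated : Nonempty I → ∀ S : StarSubalgebra ℂ carrier, IsClosed (S : Set carrier) →
    (∀ i j, e i j ∈ S) → S = ⊤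

attribute [instance] QPG.inst

/-- Equality of quantum permutation groups, where the sets acted upon are identified by `f`:
the assignment `e i j ↦ e (f i) (f j)` defines an isomorphism of unital `C*`-algebras. (By the
formula for the comultiplication, such an isomorphism respects the comultiplications.) -/
def QPG.EqVia {I : Type v} {J : Type w} [Fintype I] [Fintype J]
    (𝔾 : QPG.{u} I) (ℍ : QPG.{x} J) (f : I ≃ J) : Prop :=
  ∃ φ : 𝔾.carrier ≃⋆ₐ[ℂ] ℍ.carrier, ∀ i j, φ (𝔾.e i j) = ℍ.e (f i) (f j)

/-- Equality of quantum permutation groups acting on the same set. -/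
def QPG.Eq {I : Type v} [Fintype I] (𝔾 : QPG.{u} I) (ℍ : QPG.{x} I) : Prop :=
  𝔾.EqVia ℍ (Equiv.refl I)

/-! ### Quantum symmetric groups and quantum automorphism groups -/

section Qut

variable (I : Type u) [Fintype I]

/-- The generator `u i j`. -/
def uGen {I : Type u} (i j : I) : FreeStarAlg (I × I) := FreeStarAlg.gen (i, j)

/-- The relations of a magic unitary `u`. -/
inductive MagicRel : FreeStarAlg (I × I) → Prop
  | idem (i j : I) : MagicRel (uGen i j * uGen i j - uGen i j)
  | selfAdj (i j : I) : MagicRel (star (uGen i j) - uGen i j)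
  | row_sum (i : I) : MagicRel (∑ k, uGen i k - 1)
  | col_sum (j : I) : MagicRel (∑ k, uGen k j - 1)

/-- The presentation with generators `u i j`, the relations of a magic unitary and further
relations `R`. (The bounds `1` follow from the relations.) -/
def magicPresentation (R : Set (FreeStarAlg (I × I))) : Presentation (I × I) where
  rels := {r | MagicRel I r} ∪ R
  bound _ := 1

/-- The quantum permutation group given by the universal `C*`-algebra generated by the entries of a
magic unitary, subject to further relations `R`. -/
def universalQPG (R : Set (FreeStarAlg (I × I))) : QPG.{u} I where
  carrier := (magicPresentation I R).CStar
  e i j := (magicPresentation I R).ofFree (uGen i j)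
  magic :=
    { idem := fun i j => by
        rw [← Presentation.ofFree_mul]
        exact Presentation.ofFree_eq (Or.inl (MagicRel.idem i j))
      selfAdj := fun i j => by
        rw [← Presentation.ofFree_star]
        exact Presentation.ofFree_eq (Or.inl (MagicRel.selfAdj i j))
      row_sum := fun i => by
        have h := Presentation.ofFree_eq (P := magicPresentation I R) (Or.inl (MagicRel.row_sum i))
        rw [Presentation.ofFree_one] at h
        rw [← h]
        exact (map_sum (magicPresentation I R).ofFreeHom _ _).symm
      col_sum := fun j => by
        have h := Presentation.ofFree_eq (P := magicPresentation I R) (Or.inl (MagicRel.col_sum j))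
        rw [Presentation.ofFree_one] at h
        rw [← h]
        exact (map_sum (magicPresentation I R).ofFreeHom _ _).symm }
  generated := fun _ S hS h => Presentation.generated _ S hS fun g => h g.1 g.2

/-- The quantum symmetric group acting on `I`. -/
def quantumSymmetric : QPG.{u} I := universalQPG I ∅

/-- The quantum automorphism group of a finite graph: `u i j * u k l = 0` whenever exactly one of
`i k` and `j l` is an edge. -/
def Qut {V : Type u} [Fintype V] (X : SimpleGraph V) : QPG.{u} V :=
  universalQPG V {r | ∃ i j k l : V,
    ((X.Adj i k ∧ ¬ X.Adj j l) ∨ (¬ X.Adj i k ∧ X.Adj j l)) ∧ r = uGen i j * uGen k l}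

end Qut

/-! ### The free wreath product -/

/-- The relations which say that `f : A → FreeStarAlg G` is a unital `*`-homomorphism. -/
inductive StarHomRel {A : Type v} [CStarAlgebra A] {G : Type u} (f : A → FreeStarAlg G) :
    FreeStarAlg G → Prop
  | add (a b : A) : StarHomRel f (f (a + b) - (f a + f b))
  | smul (c : ℂ) (a : A) : StarHomRel f (f (c • a) - c • f a)
  | mul (a b : A) : StarHomRel f (f (a * b) - f a * f b)
  | star (a : A) : StarHomRel f (f (star a) - star (f a))
  | one : StarHomRel f (f 1 - 1)

section Wreath

variable {M : Type v} {N : Type w} [Fintype M] [Fintype N] (𝔾 : QPG.{u} M) (ℍ : QPG.{x} N)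

/-- The generators of `C(𝔾 ≀_* ℍ)`: one copy of `C(𝔾)` for each `a : N`, and a copy of `C(ℍ)`. -/
abbrev WreathGen : Type (max u w x) := (N × 𝔾.carrier) ⊕ ℍ.carrier

/-- An element of the `a`-th copy of `C(𝔾)`. -/
def copyG (a : N) (y : 𝔾.carrier) : FreeStarAlg (WreathGen 𝔾 ℍ) :=
  FreeStarAlg.gen (Sum.inl (a, y))

/-- An element of `C(ℍ)`. -/
def copyH (y : ℍ.carrier) : FreeStarAlg (WreathGen 𝔾 ℍ) := FreeStarAlg.gen (Sum.inr y)

/-- The relations of `C(𝔾 ≀_* ℍ)`: those of the unital free product of the copies of `C(𝔾)` and of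
`C(ℍ)`, and `u⁽ᵃ⁾ i j * v a b = v a b * u⁽ᵃ⁾ i j`. -/
inductive WreathRel : FreeStarAlg (WreathGen 𝔾 ℍ) → Prop
  | left (a : N) {r} (h : StarHomRel (copyG 𝔾 ℍ a) r) : WreathRel r
  | right {r} (h : StarHomRel (copyH 𝔾 ℍ) r) : WreathRel r
  | comm (i j : M) (a b : N) :
      WreathRel (copyG 𝔾 ℍ a (𝔾.e i j) * copyH 𝔾 ℍ (ℍ.e a b)
        - copyH 𝔾 ℍ (ℍ.e a b) * copyG 𝔾 ℍ a (𝔾.e i j))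

/-- The presentation of `C(𝔾 ≀_* ℍ)`, the quotient of the unital free product
`C(𝔾) ∗_ℂ ⋯ ∗_ℂ C(𝔾) ∗_ℂ C(ℍ)` by the commutation relations. (The bounds follow from the relations,
since `*`-homomorphisms between `C*`-algebras are contractive.) -/
def wreathPresentation : Presentation (WreathGen 𝔾 ℍ) where
  rels := {r | WreathRel 𝔾 ℍ r}
  bound := Sum.elim (fun p => ‖p.2‖) (fun y => ‖y‖)

theorem exists_starHom {A : Type v} [CStarAlgebra A] {G : Type u} {P : Presentation G}
    (f : A → FreeStarAlg G) (h : ∀ r, StarHomRel f r → r ∈ P.rels) :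
    ∃ φ : A →⋆ₐ[ℂ] P.CStar, ∀ a, φ a = P.ofFree (f a) := by
  have hs : ∀ (c : ℂ) (a : A), P.ofFree (f (c • a)) = c • P.ofFree (f a) := fun c a => by
    rw [Presentation.ofFree_eq (h _ (StarHomRel.smul c a)), Presentation.ofFree_smul]
  have h1 : P.ofFree (f 1) = 1 := by
    rw [Presentation.ofFree_eq (h _ StarHomRel.one), Presentation.ofFree_one]
  exact ⟨{  toFun := fun a => P.ofFree (f a)
            map_one' := h1
            map_mul' := fun a b => by
              rw [Presentation.ofFree_eq (h _ (StarHomRel.mul a b)), Presentation.ofFree_mul]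
            map_zero' := by
              have := hs 0 0
              rwa [zero_smul, zero_smul] at this
            map_add' := fun a b => by
              rw [Presentation.ofFree_eq (h _ (StarHomRel.add a b)), Presentation.ofFree_add]
            commutes' := fun c => by
              rw [Algebra.algebraMap_eq_smul_one, hs, h1, Algebra.algebraMap_eq_smul_one]
            map_star' := fun a => by
              rw [Presentation.ofFree_eq (h _ (StarHomRel.star a)), Presentation.ofFree_star] },
    fun a => rfl⟩

theorem continuous_starHom {A : Type v} {B : Type w} [CStarAlgebra A] [CStarAlgebra B]
    (φ : A →⋆ₐ[ℂ] B) : Continuous φ :=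
  AddMonoidHomClass.continuous_of_bound φ 1 fun a => by
    rw [one_mul]
    exact NonUnitalStarAlgHom.norm_apply_le φ a

/-- The canonical map of the `a`-th copy of `C(𝔾)` to `C(𝔾 ≀_* ℍ)`. -/
def wreathG (a : N) : 𝔾.carrier →⋆ₐ[ℂ] (wreathPresentation 𝔾 ℍ).CStar :=
  (exists_starHom (P := wreathPresentation 𝔾 ℍ) (copyG 𝔾 ℍ a)
    (fun _ h => WreathRel.left a h)).choose

theorem wreathG_apply (a : N) (y : 𝔾.carrier) :
    wreathG 𝔾 ℍ a y = (wreathPresentation 𝔾 ℍ).ofFree (copyG 𝔾 ℍ a y) :=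
  (exists_starHom (P := wreathPresentation 𝔾 ℍ) (copyG 𝔾 ℍ a)
    (fun _ h => WreathRel.left a h)).choose_spec y

/-- The canonical map of `C(ℍ)` to `C(𝔾 ≀_* ℍ)`. -/
def wreathH : ℍ.carrier →⋆ₐ[ℂ] (wreathPresentation 𝔾 ℍ).CStar :=
  (exists_starHom (P := wreathPresentation 𝔾 ℍ) (copyH 𝔾 ℍ)
    (fun _ h => WreathRel.right h)).choose

theorem wreathH_apply (y : ℍ.carrier) :
    wreathH 𝔾 ℍ y = (wreathPresentation 𝔾 ℍ).ofFree (copyH 𝔾 ℍ y) :=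
  (exists_starHom (P := wreathPresentation 𝔾 ℍ) (copyH 𝔾 ℍ)
    (fun _ h => WreathRel.right h)).choose_spec y

theorem wreath_comm (i j : M) (a b : N) :
    wreathG 𝔾 ℍ a (𝔾.e i j) * wreathH 𝔾 ℍ (ℍ.e a b)
      = wreathH 𝔾 ℍ (ℍ.e a b) * wreathG 𝔾 ℍ a (𝔾.e i j) := by
  rw [wreathG_apply, wreathH_apply, ← Presentation.ofFree_mul, ← Presentation.ofFree_mul]
  exact Presentation.ofFree_eq (WreathRel.comm i j a b)

/-- The fundamental representation `w (a, i) (b, j) = u⁽ᵃ⁾ i j * v a b`. -/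
def wreathEntry (p q : N × M) : (wreathPresentation 𝔾 ℍ).CStar :=
  wreathG 𝔾 ℍ p.1 (𝔾.e p.2 q.2) * wreathH 𝔾 ℍ (ℍ.e p.1 q.1)

theorem wreathEntry_magic : IsMagicUnitary (wreathEntry 𝔾 ℍ) where
  idem p q := by
    unfold wreathEntry
    rw [mul_assoc, ← mul_assoc (wreathH 𝔾 ℍ _), ← wreath_comm, mul_assoc, ← map_mul,
      ℍ.magic.idem, ← mul_assoc, ← map_mul, 𝔾.magic.idem]
  selfAdj p q := by
    unfold wreathEntry
    rw [star_mul, ← map_star, ← map_star, ℍ.magic.selfAdj, 𝔾.magic.selfAdj, wreath_comm]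
  row_sum p := by
    unfold wreathEntry
    rw [Fintype.sum_prod_type]
    have h : ∀ b : N, ∑ j : M, wreathG 𝔾 ℍ p.1 (𝔾.e p.2 j) * wreathH 𝔾 ℍ (ℍ.e p.1 b)
        = wreathH 𝔾 ℍ (ℍ.e p.1 b) := fun b => by
      rw [← Finset.sum_mul, ← map_sum, 𝔾.magic.row_sum, map_one, one_mul]
    simp only [h]
    rw [← map_sum, ℍ.magic.row_sum, map_one]
  col_sum q := by
    unfold wreathEntry
    rw [Fintype.sum_prod_type]
    have h : ∀ a : N, ∑ i : M, wreathG 𝔾 ℍ a (𝔾.e i q.2) * wreathH 𝔾 ℍ (ℍ.e a q.1)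
        = wreathH 𝔾 ℍ (ℍ.e a q.1) := fun a => by
      rw [← Finset.sum_mul, ← map_sum, 𝔾.magic.col_sum, map_one, one_mul]
    simp only [h]
    rw [← map_sum, ℍ.magic.col_sum, map_one]

/-- The free wreath product `𝔾 ≀_* ℍ`, acting on `N × M`. -/
def freeWreath : QPG.{max u w x} (N × M) where
  carrier := (wreathPresentation 𝔾 ℍ).CStar
  e := wreathEntry 𝔾 ℍ
  magic := wreathEntry_magic 𝔾 ℍ
  generated := by
    rintro ⟨⟨a₀, i₀⟩⟩ S hS h
    have hG : ∀ (a : N) (y : 𝔾.carrier), wreathG 𝔾 ℍ a y ∈ S := by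
      intro a
      have hc : Continuous (wreathG 𝔾 ℍ a) := continuous_starHom _
      have ht := 𝔾.generated ⟨i₀⟩ (S.comap (wreathG 𝔾 ℍ a)) (hS.preimage hc) (fun i j => by
        rw [StarSubalgebra.mem_comap]
        have hw : wreathG 𝔾 ℍ a (𝔾.e i j) = ∑ b : N, wreathEntry 𝔾 ℍ (a, i) (b, j) := by
          simp only [wreathEntry]
          rw [← Finset.mul_sum, ← map_sum, ℍ.magic.row_sum, map_one, mul_one]
        rw [hw]
        exact sum_mem fun b _ => h _ _)
      intro y
      have : y ∈ S.comap (wreathG 𝔾 ℍ a) := by rw [ht]; trivial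
      exact this
    have hH : ∀ y : ℍ.carrier, wreathH 𝔾 ℍ y ∈ S := by
      have hc : Continuous (wreathH 𝔾 ℍ) := continuous_starHom _
      have ht := ℍ.generated ⟨a₀⟩ (S.comap (wreathH 𝔾 ℍ)) (hS.preimage hc) (fun a b => by
        rw [StarSubalgebra.mem_comap]
        have hw : wreathH 𝔾 ℍ (ℍ.e a b) = ∑ j : M, wreathEntry 𝔾 ℍ (a, i₀) (b, j) := by
          simp only [wreathEntry]
          rw [← Finset.sum_mul, ← map_sum, 𝔾.magic.row_sum, map_one, one_mul]
        rw [hw]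
        exact sum_mem fun b _ => h _ _)
      intro y
      have : y ∈ S.comap (wreathH 𝔾 ℍ) := by rw [ht]; trivial
      exact this
    refine Presentation.generated _ S hS ?_
    rintro (⟨a, y⟩ | y)
    · have := hG a y
      rwa [wreathG_apply] at this
    · have := hH y
      rwa [wreathH_apply] at this

end Wreath

/-- The identification of vertices `X[Y] = X'[L_α][L_β[Y']] = X'[L_{αβ}[Y']]` that comes from
`X = X'[L_α]` and `Y = L_β[Y']`. -/
def regroup {V V' W W' : Type u} {α β : ℕ} (f : V ≃ V' × Fin α) (g : W ≃ Fin β × W') :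
    V × W ≃ V' × (Fin (α * β) × W') where
  toFun p := ((f p.1).1, (finProdFinEquiv ((f p.1).2, (g p.2).1), (g p.2).2))
  invFun q := (f.symm (q.1, (finProdFinEquiv.symm q.2.1).1),
    g.symm ((finProdFinEquiv.symm q.2.1).2, q.2.2))
  left_inv p := by simp
  right_inv q := by simp [-finProdFinEquiv_symm_apply]

end QuantumAut

end

/-! A magic unitary `e` respects a relation `R` if `e i j * e k l = 0` whenever exactly one of `R i
k`, `R j l` holds. Respected relations are closed under Boolean operations, under thresholds on the
number of two-step paths (`Respects.le_card`) and under reflexive transitive closure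
(`Respects.reflTransGen`). So whatever is built from adjacency by these operations is preserved by
the quantum automorphism group, just as by the classical one.

The core is a quantum form of Sabidussi's theorem, `Qut_lex`: if `X` is vertex-transitive, `Y` is
connected whenever `X` has twins, and the complement of `Y` is connected whenever the complement of
`X` has twins, then the quantum automorphism group of `X[Y]` is the free wreath product. Under these
conditions the relation "same fibre over `X`" is built from adjacency: for twin-free `X` of degree
`k`, two nonadjacent vertices of `X[Y]` have at least `k * |W|` common neighbours exactly when they
lie in one fibre. Vertex-transitivity forbids twins in both `X` and its complement, so this argument
applies to at least one of them. Once fibres are respected, each entry of the magic unitary is a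
commuting product of an entry acting inside a fibre and an entry acting on the set of fibres, which
are the generators of the free wreath product.

Hence if equality fails, one of the conditions fails. Up to complements, `X` has twins and `Y` is
disconnected. By transitivity, twin classes of `X` have equal size and components of `Y` are
isomorphic, which gives the two factorizations. If the factorizations are maximal, `X'` has no twins
and `Y'` is connected. Then `X[Y]` regroups as a product of `X'` with the product of an edgeless
graph on `α * β` vertices with `Y'`, and both products satisfy Sabidussi's conditions. Case (b) is
case (a) for the complements. -/

noncomputable section

namespace QuantumAut

/-! ### Universal property of presented `C*`-algebras -/

namespace FreeStarAlg

/-- The `*`-homomorphism that extends a map on the generators. -/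
def lift {G : Type u} {B : Type v} [CStarAlgebra B] (f : G → B) : FreeStarAlg G →⋆ₐ[ℂ] B :=
  let F : FreeAlgebra ℂ (G ⊕ G) →ₐ[ℂ] B := FreeAlgebra.lift ℂ (Sum.elim f fun g => star (f g))
  have hF : ∀ s, F (FreeAlgebra.ι ℂ s) = Sum.elim f (fun g => star (f g)) s :=
    fun s => FreeAlgebra.lift_ι_apply _ s
  { toFun := F
    map_one' := map_one F
    map_mul' := map_mul F
    map_zero' := map_zero F
    map_add' := map_add F
    commutes' := F.commutes
    map_star' := fun a => by
      induction a using induction with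
      | hc c =>
        rw [star_algebraMap]
        exact (F.commutes _).trans
          ((algebraMap_star_comm c).trans (congrArg star (F.commutes c).symm))
      | hl s =>
        rw [star_letter]
        refine (hF _).trans (Eq.trans ?_ (congrArg star (hF s).symm))
        rcases s with g | g <;> simp
      | hm a b ha hb =>
        rw [star_mul]
        exact (map_mul F _ _).trans ((congrArg₂ (· * ·) hb ha).trans
          ((star_mul _ _).symm.trans (congrArg star (map_mul F a b).symm)))
      | ha a b ha hb =>
        rw [star_add]
        exact (map_add F _ _).trans ((congrArg₂ (· + ·) ha hb).trans
          ((star_add _ _).symm.trans (congrArg star (map_add F a b).symm))) }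

theorem lift_gen {G : Type u} {B : Type v} [CStarAlgebra B] (f : G → B) (g : G) :
    lift f (gen g) = f g :=
  FreeAlgebra.lift_ι_apply (R := ℂ) (X := G ⊕ G) _ (Sum.inl g)

end FreeStarAlg

/-- The universal property of the `C*`-algebra of a presentation. -/
theorem Presentation.exists_lift {G : Type u} {B : Type v} [CStarAlgebra B] (P : Presentation G)
    (f : G → B) (hrel : ∀ r ∈ P.rels, FreeStarAlg.lift f r = 0) (hb : ∀ g, ‖f g‖ ≤ P.bound g) :
    ∃ φ : P.CStar →⋆ₐ[ℂ] B, ∀ a, φ (P.ofFree a) = FreeStarAlg.lift f a := by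
  let F := FreeStarAlg.lift f
  -- The seminorm `‖F a‖` is one of those in the supremum defining `univNorm`, so `F` is contractive
  -- for the universal seminorm and extends to the completion.
  let p : P.CStarSeminorm :=
    { toFun := fun a => ‖F a‖
      map_zero' := by simp
      add_le' := fun a b => by rw [map_add]; exact norm_add_le _ _
      neg' := fun a => by rw [map_neg, norm_neg]
      smul' := fun c a => by rw [map_smul, norm_smul]
      mul_le' := fun a b => by
        rw [map_mul]; exact norm_mul_le _ _
      star_mul_self' := fun a => by
        rw [map_mul, map_star]; exact CStarRing.norm_star_mul_self
      rel' := fun r hr => by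
        rw [norm_eq_zero]; exact hrel r hr
      bound' := fun g => by
        rw [show F (FreeStarAlg.gen g) = f g from FreeStarAlg.lift_gen f g]; exact hb g }
  let F' : P.Pre →+ B := { toFun := F, map_zero' := map_zero F, map_add' := map_add F }
  have hu : UniformContinuous F' :=
    (AddMonoidHomClass.lipschitz_of_bound F' 1 fun a => by
      rw [one_mul]; exact P.le_univNorm p a).uniformContinuous
  let φ : P.CStar → B := UniformSpace.Completion.extension F'
  have hc : Continuous φ := UniformSpace.Completion.continuous_extension
  have hφ : ∀ a, φ (P.ofFree a) = F a := fun a => UniformSpace.Completion.extension_coe hu _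
  have h1 : φ 1 = 1 := by rw [← ofFree_one, hφ, map_one]
  have hs : ∀ (c : ℂ) x, φ (c • x) = c • φ x := fun c x => by
    induction x using cstar_induction with
    | hC => exact isClosed_eq (hc.comp (continuous_const_smul c)) (hc.const_smul c)
    | h a => rw [← ofFree_smul, hφ, hφ, map_smul]
  refine ⟨{ toFun := φ
            map_one' := h1
            map_mul' := fun x y => ?_
            map_zero' := by rw [← ofFree_zero, hφ, map_zero]
            map_add' := fun x y => ?_
            commutes' := fun c => by
              rw [Algebra.algebraMap_eq_smul_one, hs, h1, Algebra.algebraMap_eq_smul_one]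
            map_star' := fun x => ?_ }, hφ⟩
  · induction x, y using cstar_induction₂ with
    | hC =>
      exact isClosed_eq (hc.comp continuous_mul)
        ((hc.comp continuous_fst).mul (hc.comp continuous_snd))
    | h a b => rw [← ofFree_mul, hφ, hφ, hφ, map_mul]
  · induction x, y using cstar_induction₂ with
    | hC =>
      exact isClosed_eq (hc.comp continuous_add)
        ((hc.comp continuous_fst).add (hc.comp continuous_snd))
    | h a b => rw [← ofFree_add, hφ, hφ, hφ, map_add]
  · induction x using cstar_induction with
    | hC => exact isClosed_eq (hc.comp continuous_star) (continuous_star.comp hc)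
    | h a => rw [← ofFree_star, hφ, hφ, map_star]

/-! ### Magic unitaries in `C*`-algebras -/

/-- Compressing `∑ k, p k = 1` by `p j` gives `∑ k, p j * p k * p j = p j`. Removing the term `k =
j` leaves a vanishing sum of the positive elements `star (p k * p j) * (p k * p j)`, so each of them
is zero. -/
theorem mul_eq_zero_of_sum_eq_one {ι : Type v} [Fintype ι] {A : Type u} [CStarAlgebra A]
    {p : ι → A} (hi : ∀ i, p i * p i = p i) (hs : ∀ i, star (p i) = p i) (h1 : ∑ i, p i = 1)
    {i j : ι} (hij : i ≠ j) : p i * p j = 0 := by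
  classical
  let _ := CStarAlgebra.spectralOrder A
  have := CStarAlgebra.spectralOrderedRing A
  have hq : ∀ k, star (p k * p j) * (p k * p j) = p j * p k * p j := fun k => by
    rw [star_mul, hs, hs, mul_assoc, ← mul_assoc (p k), hi, mul_assoc]
  have h : ∑ k ∈ Finset.univ.erase j, star (p k * p j) * (p k * p j) = 0 := by
    have hsum : ∑ k, p j * p k * p j = p j := by
      rw [← Finset.sum_mul, ← Finset.mul_sum, h1, mul_one, hi]
    rw [← Finset.add_sum_erase Finset.univ _ (Finset.mem_univ j), hi, hi] at hsum
    simp only [hq]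
    simpa using hsum
  rw [Finset.sum_eq_zero_iff_of_nonneg fun k _ => star_mul_self_nonneg _] at h
  exact CStarRing.star_mul_self_eq_zero_iff _ |>.1
    (h i (Finset.mem_erase.2 ⟨hij, Finset.mem_univ _⟩))

namespace IsMagicUnitary

variable {I : Type v} [Fintype I] {A : Type u} [CStarAlgebra A] {e : I → I → A}

theorem row_mul (h : IsMagicUnitary e) (i : I) {j k : I} (hjk : j ≠ k) : e i j * e i k = 0 :=
  mul_eq_zero_of_sum_eq_one (p := e i) (h.idem i) (h.selfAdj i) (h.row_sum i) hjk

theorem col_mul (h : IsMagicUnitary e) (j : I) {i k : I} (hik : i ≠ k) : e i j * e k j = 0 :=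
  mul_eq_zero_of_sum_eq_one (p := fun i => e i j) (fun i => h.idem i j) (fun i => h.selfAdj i j)
    (h.col_sum j) hik

theorem norm_le_one (h : IsMagicUnitary e) (i j : I) : ‖e i j‖ ≤ 1 :=
  IsStarProjection.norm_le _ ⟨h.idem i j, h.selfAdj i j⟩

theorem reindex (h : IsMagicUnitary e) {J : Type w} [Fintype J] (f : J ≃ I) :
    IsMagicUnitary fun i j => e (f i) (f j) where
  idem _ _ := h.idem _ _
  selfAdj _ _ := h.selfAdj _ _
  row_sum i := (f.sum_comp fun k => e (f i) k).trans (h.row_sum _)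
  col_sum j := (f.sum_comp fun k => e k (f j)).trans (h.col_sum _)

/-- The relations `u i k * u j l = 0` whenever exactly one of `R i j`, `R k l` holds. -/
def Respects (e : I → I → A) (R : I → I → Prop) : Prop :=
  ∀ i j k l, ¬ (R i k ↔ R j l) → e i j * e k l = 0

end IsMagicUnitary

open IsMagicUnitary

/-! ### Homomorphisms between quantum permutation groups -/

/-- The entries of the magic unitary generate, whether or not the set acted upon is empty. -/
def QPG.Generates {I : Type v} [Fintype I] (𝔾 : QPG.{u} I) : Prop :=
  ∀ S : StarSubalgebra ℂ 𝔾.carrier, IsClosed (S : Set 𝔾.carrier) → (∀ i j, 𝔾.e i j ∈ S) → S = ⊤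

/-- The equalizer of two `*`-homomorphisms is a closed `*`-subalgebra, by automatic continuity. -/
theorem QPG.Generates.hom_ext {I : Type v} [Fintype I] {𝔾 : QPG.{u} I} (h : 𝔾.Generates)
    {B : Type w} [CStarAlgebra B] {φ ψ : 𝔾.carrier →⋆ₐ[ℂ] B}
    (he : ∀ i j, φ (𝔾.e i j) = ψ (𝔾.e i j)) : φ = ψ := by
  have ht := h (StarAlgHom.equalizer φ ψ)
    (isClosed_eq (continuous_starHom φ) (continuous_starHom ψ)) he
  ext y
  have : y ∈ StarAlgHom.equalizer φ ψ := by rw [ht]; trivial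
  exact this

theorem QPG.EqVia.of_homs {I : Type v} {J : Type w} [Fintype I] [Fintype J] {𝔾 : QPG.{u} I}
    {ℍ : QPG.{x} J} (f : I ≃ J) (hG : 𝔾.Generates) (hH : ℍ.Generates)
    (φ : 𝔾.carrier →⋆ₐ[ℂ] ℍ.carrier) (hφ : ∀ i j, φ (𝔾.e i j) = ℍ.e (f i) (f j))
    (ψ : ℍ.carrier →⋆ₐ[ℂ] 𝔾.carrier) (hψ : ∀ i j, ψ (ℍ.e (f i) (f j)) = 𝔾.e i j) :
    𝔾.EqVia ℍ f :=
  ⟨StarAlgEquiv.ofStarAlgHom φ ψ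
    (hG.hom_ext fun i j => by simp [hφ, hψ])
    (hH.hom_ext fun i j => by
      obtain ⟨i, rfl⟩ := f.surjective i
      obtain ⟨j, rfl⟩ := f.surjective j
      simp [hφ, hψ]), hφ⟩

theorem QPG.EqVia.trans {I J K : Type*} [Fintype I] [Fintype J] [Fintype K] {𝔾 : QPG.{u} I}
    {ℍ : QPG.{v} J} {𝕂 : QPG.{w} K} {f : I ≃ J} {g : J ≃ K} (h : 𝔾.EqVia ℍ f)
    (h' : ℍ.EqVia 𝕂 g) : 𝔾.EqVia 𝕂 (f.trans g) := by
  obtain ⟨φ, hφ⟩ := h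
  obtain ⟨ψ, hψ⟩ := h'
  exact ⟨φ.trans ψ, fun i j => by simp [hφ, hψ]⟩

theorem QPG.EqVia.symm {I J : Type*} [Fintype I] [Fintype J] {𝔾 : QPG.{u} I}
    {ℍ : QPG.{v} J} {f : I ≃ J} (h : 𝔾.EqVia ℍ f) : ℍ.EqVia 𝔾 f.symm := by
  obtain ⟨φ, hφ⟩ := h
  exact ⟨φ.symm, fun i j => by rw [StarAlgEquiv.symm_apply_eq, hφ]; simp⟩

theorem QPG.EqVia.of_eq {I J : Type*} [Fintype I] [Fintype J] {𝔾 : QPG.{u} I} {ℍ : QPG.{v} J}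
    {f g : I ≃ J} (h : 𝔾.EqVia ℍ f) (hfg : f = g) : 𝔾.EqVia ℍ g :=
  hfg ▸ h

theorem universalQPG_generates (I : Type u) [Fintype I] (R : Set (FreeStarAlg (I × I))) :
    (universalQPG I R).Generates :=
  fun S hS h => Presentation.generated _ S hS fun g => h g.1 g.2

theorem exists_universalQPG_hom {I : Type u} [Fintype I] (R : Set (FreeStarAlg (I × I)))
    {B : Type v} [CStarAlgebra B] {e : I → I → B} (he : IsMagicUnitary e)
    (hR : ∀ r ∈ R, FreeStarAlg.lift (fun p : I × I => e p.1 p.2) r = 0) :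
    ∃ φ : (universalQPG I R).carrier →⋆ₐ[ℂ] B, ∀ i j, φ ((universalQPG I R).e i j) = e i j := by
  have hg : ∀ i j, FreeStarAlg.lift (fun p : I × I => e p.1 p.2) (uGen i j) = e i j :=
    fun i j => FreeStarAlg.lift_gen _ (i, j)
  obtain ⟨φ, hφ⟩ := (magicPresentation I R).exists_lift (fun p : I × I => e p.1 p.2)
    (by
      rintro r (hr | hr)
      · rcases hr with ⟨i, j⟩ | ⟨i, j⟩ | ⟨i⟩ | ⟨j⟩
        · rw [map_sub, map_mul, hg, he.idem, sub_self]
        · rw [map_sub, map_star, hg, he.selfAdj, sub_self]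
        · rw [map_sub, map_sum, map_one, sub_eq_zero, ← he.row_sum i]
          exact Finset.sum_congr rfl fun k _ => hg i k
        · rw [map_sub, map_sum, map_one, sub_eq_zero, ← he.col_sum j]
          exact Finset.sum_congr rfl fun k _ => hg k j
      · exact hR r hr)
    (fun g => he.norm_le_one _ _)
  exact ⟨φ, fun i j => (hφ _).trans (hg i j)⟩

/-! ### Universal property of quantum automorphism groups, and invariance under isomorphism and
complement -/

theorem Qut_respects {V : Type u} [Fintype V] (X : SimpleGraph V) :
    Respects (Qut X).e X.Adj := by
  intro i j k l h
  rw [show (Qut X).e i j * (Qut X).e k l = _ from (Presentation.ofFree_mul _ _).symm]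
  refine Presentation.ofFree_rel (Or.inr ⟨i, j, k, l, ?_, rfl⟩)
  tauto

theorem exists_Qut_hom {V : Type u} [Fintype V] (X : SimpleGraph V) {B : Type v} [CStarAlgebra B]
    {e : V → V → B} (he : IsMagicUnitary e) (hX : Respects e X.Adj) :
    ∃ φ : (Qut X).carrier →⋆ₐ[ℂ] B, ∀ i j, φ ((Qut X).e i j) = e i j := by
  refine exists_universalQPG_hom _ he ?_
  rintro r ⟨i, j, k, l, h, rfl⟩
  rw [map_mul]
  refine (congrArg₂ (· * ·) (FreeStarAlg.lift_gen _ (i, j)) (FreeStarAlg.lift_gen _ (k, l))).trans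
    (hX i j k l ?_)
  tauto

theorem Qut_generates {V : Type u} [Fintype V] (X : SimpleGraph V) : (Qut X).Generates :=
  universalQPG_generates _ _

/-- Equality of vertices is respected by every magic unitary, since distinct entries of a row or a
column are orthogonal. On pairs of distinct vertices, adjacency in the complement is just the
negation. -/
theorem IsMagicUnitary.Respects.compl {V : Type v} [Fintype V] {A : Type u} [CStarAlgebra A]
    {e : V → V → A} (he : IsMagicUnitary e) {X : SimpleGraph V} (h : Respects e X.Adj) :
    Respects e Xᶜ.Adj := by
  intro i j k l hn
  by_cases hik : i = k
  · subst hik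
    by_cases hjl : j = l
    · subst hjl; simp at hn
    · exact he.row_mul _ hjl
  · by_cases hjl : j = l
    · subst hjl; exact he.col_mul _ hik
    · refine h i j k l fun h' => hn ?_
      rw [SimpleGraph.compl_adj, SimpleGraph.compl_adj, h']
      simp [hik, hjl]

theorem Qut_eqVia_of_iso {V : Type u} {W : Type v} [Fintype V] [Fintype W] {X : SimpleGraph V}
    {Y : SimpleGraph W} (f : X ≃g Y) : (Qut X).EqVia (Qut Y) f.toEquiv := by
  obtain ⟨φ, hφ⟩ := exists_Qut_hom X ((Qut Y).magic.reindex f.toEquiv)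
    (fun i j k l h => Qut_respects Y _ _ _ _ (by
      change ¬ (Y.Adj (f i) (f k) ↔ Y.Adj (f j) (f l))
      rwa [f.map_adj_iff, f.map_adj_iff]))
  obtain ⟨ψ, hψ⟩ := exists_Qut_hom Y ((Qut X).magic.reindex f.symm.toEquiv)
    (fun i j k l h => Qut_respects X _ _ _ _ (by
      change ¬ (X.Adj (f.symm i) (f.symm k) ↔ X.Adj (f.symm j) (f.symm l))
      rwa [f.symm.map_adj_iff, f.symm.map_adj_iff]))
  exact QPG.EqVia.of_homs f.toEquiv (Qut_generates X) (Qut_generates Y) φ hφ ψ fun i j => by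
    rw [hψ]
    exact congrArg₂ (Qut X).e (f.symm_apply_apply i) (f.symm_apply_apply j)

theorem Qut_compl {V : Type u} [Fintype V] (X : SimpleGraph V) : (Qut Xᶜ).Eq (Qut X) := by
  obtain ⟨φ, hφ⟩ := exists_Qut_hom Xᶜ (Qut X).magic ((Qut_respects X).compl (Qut X).magic)
  obtain ⟨ψ, hψ⟩ := exists_Qut_hom X (Qut Xᶜ).magic (by
    have h := (Qut_respects Xᶜ).compl (Qut Xᶜ).magic
    rwa [compl_compl] at h)
  exact QPG.EqVia.of_homs _ (Qut_generates _) (Qut_generates _) φ hφ ψ hψ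

theorem Qut_bot (V : Type u) [Fintype V] :
    Qut (⊥ : SimpleGraph V) = quantumSymmetric V := by
  unfold Qut quantumSymmetric
  congr 1
  ext r
  simp

/-! ### The universal property of the free wreath product -/

section Wreath

variable {M : Type v} {N : Type w} [Fintype M] [Fintype N] {𝔾 : QPG.{u} M} {ℍ : QPG.{x} N}

theorem exists_freeWreath_hom {B : Type*} [CStarAlgebra B] (φ : N → 𝔾.carrier →⋆ₐ[ℂ] B)
    (ψ : ℍ.carrier →⋆ₐ[ℂ] B)
    (hc : ∀ i j a b, φ a (𝔾.e i j) * ψ (ℍ.e a b) = ψ (ℍ.e a b) * φ a (𝔾.e i j)) :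
    ∃ θ : (freeWreath 𝔾 ℍ).carrier →⋆ₐ[ℂ] B, ∀ p q,
      θ ((freeWreath 𝔾 ℍ).e p q) = φ p.1 (𝔾.e p.2 q.2) * ψ (ℍ.e p.1 q.1) := by
  let f : WreathGen 𝔾 ℍ → B := Sum.elim (fun p => φ p.1 p.2) ψ
  have hG : ∀ a y, FreeStarAlg.lift f (copyG 𝔾 ℍ a y) = φ a y :=
    fun a y => FreeStarAlg.lift_gen f (Sum.inl (a, y))
  have hH : ∀ y, FreeStarAlg.lift f (copyH 𝔾 ℍ y) = ψ y :=
    fun y => FreeStarAlg.lift_gen f (Sum.inr y)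
  obtain ⟨θ, hθ⟩ := (wreathPresentation 𝔾 ℍ).exists_lift f
    (by
      rintro r (⟨a, h⟩ | h | ⟨i, j, a, b⟩)
      · rcases h with ⟨y, z⟩ | ⟨c, y⟩ | ⟨y, z⟩ | ⟨y⟩ | _ <;>
          simp [hG, map_sub, map_add, map_mul, map_star, map_one]
      · rcases h with ⟨y, z⟩ | ⟨c, y⟩ | ⟨y, z⟩ | ⟨y⟩ | _ <;>
          simp [hH, map_sub, map_add, map_mul, map_star, map_one]
      · rw [map_sub, map_mul, map_mul, hG, hH, hc, sub_self])
    (by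
      rintro (⟨a, y⟩ | y)
      · exact NonUnitalStarAlgHom.norm_apply_le (φ a) y
      · exact NonUnitalStarAlgHom.norm_apply_le ψ y)
  refine ⟨θ, fun p q => ?_⟩
  change θ (wreathG 𝔾 ℍ _ _ * wreathH 𝔾 ℍ _) = _
  rw [map_mul, wreathG_apply, wreathH_apply, hθ, hθ, hG, hH]

theorem sum_wreathEntry_snd (a b : N) (i : M) :
    ∑ j, wreathEntry 𝔾 ℍ (a, i) (b, j) = wreathH 𝔾 ℍ (ℍ.e a b) := by
  change ∑ j, wreathG 𝔾 ℍ a (𝔾.e i j) * wreathH 𝔾 ℍ (ℍ.e a b) = _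
  rw [← Finset.sum_mul, ← map_sum, 𝔾.magic.row_sum, map_one, one_mul]

theorem sum_wreathEntry_fst (a : N) (i j : M) :
    ∑ b, wreathEntry 𝔾 ℍ (a, i) (b, j) = wreathG 𝔾 ℍ a (𝔾.e i j) := by
  change ∑ b, wreathG 𝔾 ℍ a (𝔾.e i j) * wreathH 𝔾 ℍ (ℍ.e a b) = _
  rw [← Finset.mul_sum, ← map_sum, ℍ.magic.row_sum, map_one, mul_one]

/-- Summing entries over `M` recovers the copy of `C(ℍ)`, and summing over `N` recovers the copies
of `C(𝔾)`. Unlike `QPG.generated`, this covers empty `N`. -/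
theorem freeWreath_generates [Nonempty M] (hG : 𝔾.Generates) (hH : ℍ.Generates) :
    (freeWreath 𝔾 ℍ).Generates := by
  change ∀ S : StarSubalgebra ℂ (wreathPresentation 𝔾 ℍ).CStar,
    IsClosed (S : Set (wreathPresentation 𝔾 ℍ).CStar) → (∀ p q, wreathEntry 𝔾 ℍ p q ∈ S) → S = ⊤
  intro S hS h
  have hSG : ∀ a y, wreathG 𝔾 ℍ a y ∈ S := fun a y => by
    have ht := hG (S.comap (wreathG 𝔾 ℍ a)) (hS.preimage (continuous_starHom _)) fun i j => by
      rw [StarSubalgebra.mem_comap, ← sum_wreathEntry_fst]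
      exact sum_mem fun b _ => h _ _
    have : y ∈ S.comap (wreathG 𝔾 ℍ a) := by rw [ht]; trivial
    exact this
  have hSH : ∀ y, wreathH 𝔾 ℍ y ∈ S := fun y => by
    have ht := hH (S.comap (wreathH 𝔾 ℍ)) (hS.preimage (continuous_starHom _)) fun a b => by
      rw [StarSubalgebra.mem_comap, ← sum_wreathEntry_snd a b (Classical.arbitrary M)]
      exact sum_mem fun b _ => h _ _
    have : y ∈ S.comap (wreathH 𝔾 ℍ) := by rw [ht]; trivial
    exact this
  refine Presentation.generated _ S hS ?_
  rintro (⟨a, y⟩ | y)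
  · exact wreathG_apply 𝔾 ℍ a y ▸ hSG a y
  · exact wreathH_apply 𝔾 ℍ y ▸ hSH y

end Wreath

theorem exists_freeWreath_hom_congr {M M' N : Type*} [Fintype M] [Fintype M'] [Fintype N]
    {𝔾 : QPG.{u} M} {𝔾' : QPG.{v} M'} {ℍ : QPG.{w} N} {ℍ' : QPG.{x} N} {f : M ≃ M'}
    (h : 𝔾.EqVia 𝔾' f) (h' : ℍ.Eq ℍ') :
    ∃ θ : (freeWreath 𝔾 ℍ).carrier →⋆ₐ[ℂ] (freeWreath 𝔾' ℍ').carrier, ∀ p q,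
      θ ((freeWreath 𝔾 ℍ).e p q) =
        (freeWreath 𝔾' ℍ').e ((Equiv.refl N).prodCongr f p) ((Equiv.refl N).prodCongr f q) := by
  obtain ⟨φ, hφ⟩ := h
  obtain ⟨ψ, hψ⟩ := h'
  obtain ⟨θ, hθ⟩ := exists_freeWreath_hom (𝔾 := 𝔾) (ℍ := ℍ) (B := (wreathPresentation 𝔾' ℍ').CStar)
    (fun a => (wreathG 𝔾' ℍ' a).comp (φ : 𝔾.carrier →⋆ₐ[ℂ] 𝔾'.carrier))
    ((wreathH 𝔾' ℍ').comp (ψ : ℍ.carrier →⋆ₐ[ℂ] ℍ'.carrier))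
    (fun i j a b => by
      have hG : ∀ i j, (φ : 𝔾.carrier →⋆ₐ[ℂ] 𝔾'.carrier) (𝔾.e i j) = 𝔾'.e (f i) (f j) := hφ
      have hH : ∀ i j, (ψ : ℍ.carrier →⋆ₐ[ℂ] ℍ'.carrier) (ℍ.e i j) = ℍ'.e i j := hψ
      rw [StarAlgHom.comp_apply, StarAlgHom.comp_apply, hG, hH, wreath_comm])
  exact ⟨θ, fun p q => (hθ p q).trans
    (congrArg₂ (fun y z => wreathG 𝔾' ℍ' p.1 y * wreathH 𝔾' ℍ' z) (hφ _ _) (hψ _ _))⟩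

theorem freeWreath_congr {M M' N : Type*} [Fintype M] [Fintype M'] [Fintype N] [Nonempty M]
    {𝔾 : QPG.{u} M} {𝔾' : QPG.{v} M'} {ℍ : QPG.{w} N} {ℍ' : QPG.{x} N} {f : M ≃ M'}
    (hG : 𝔾.Generates) (hG' : 𝔾'.Generates) (hH : ℍ.Generates) (hH' : ℍ'.Generates)
    (h : 𝔾.EqVia 𝔾' f) (h' : ℍ.Eq ℍ') :
    (freeWreath 𝔾 ℍ).EqVia (freeWreath 𝔾' ℍ') ((Equiv.refl N).prodCongr f) := by
  have : Nonempty M' := f.nonempty_congr.1 ‹_›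
  obtain ⟨θ, hθ⟩ := exists_freeWreath_hom_congr h h'
  obtain ⟨η, hη⟩ := exists_freeWreath_hom_congr h.symm h'.symm
  exact QPG.EqVia.of_homs _ (freeWreath_generates hG hH) (freeWreath_generates hG' hH') θ hθ η
    fun p q => (hη _ _).trans (congrArg₂ _ (by ext <;> simp) (by ext <;> simp))

/-! ### Relations respected by a magic unitary -/

namespace IsMagicUnitary

variable {I : Type v} {A : Type u} [CStarAlgebra A] {e : I → I → A} {R S : I → I → Prop}

theorem Respects.transpose (h : Respects e R) : Respects (fun i j => e j i) R :=
  fun i j k l hn => h j i l k fun h' => hn h'.symm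

theorem Respects.and (hR : Respects e R) (hS : Respects e S) :
    Respects e fun i k => R i k ∧ S i k := fun i j k l hn => by
  by_cases h : R i k ↔ R j l
  · exact hS i j k l fun h' => hn (and_congr h h')
  · exact hR i j k l h

theorem Respects.not (hR : Respects e R) : Respects e fun i k => ¬ R i k :=
  fun i j k l hn => hR i j k l fun h => hn (not_congr h)

theorem Respects.or (hR : Respects e R) (hS : Respects e S) :
    Respects e fun i k => R i k ∨ S i k := fun i j k l hn => by
  by_cases h : R i k ↔ R j l
  · exact hS i j k l fun h' => hn (or_congr h h')
  · exact hR i j k l h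

variable [Fintype I]

theorem transpose (h : IsMagicUnitary e) : IsMagicUnitary fun i j => e j i :=
  ⟨fun i j => h.idem j i, fun i j => h.selfAdj j i, h.col_sum, h.row_sum⟩

theorem sum_mid_row (he : IsMagicUnitary e) (a b : A) (h : I) :
    ∑ g, a * e h g * b = a * b := by
  rw [← Finset.sum_mul, ← Finset.mul_sum, he.row_sum, mul_one]

theorem sum_mid_col (he : IsMagicUnitary e) (a b : A) (g : I) :
    ∑ h, a * e h g * b = a * b := by
  rw [← Finset.sum_mul, ← Finset.mul_sum, he.col_sum, mul_one]

-- Insert `e h g` between the two factors and sum over the paths from `i` to `k` through `h`. A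
-- nonzero term requires the pairs `(i, h)`, `(j, g)` to agree on `R` and `(h, k)`, `(g, l)` to
-- agree on `S`, so the same sum runs over the paths from `j` to `l` through `g`. Row sums evaluate
-- it as the first count times `e i j * e k l`, column sums as the second.
open Finset Classical in
theorem Respects.mul_eq_zero_of_card_ne (he : IsMagicUnitary e) (hR : Respects e R)
    (hS : Respects e S) {i j k l : I}
    (hn : #{h | R i h ∧ S h k} ≠ #{g | R j g ∧ S g l}) : e i j * e k l = 0 := by
  have key : ∀ h g, (if R i h ∧ S h k then e i j * e h g * e k l else 0)
      = if R j g ∧ S g l then e i j * e h g * e k l else 0 := fun h g => by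
    by_cases h1 : R i h ↔ R j g
    · by_cases h2 : S h k ↔ S g l
      · rw [h1, h2]
      · rw [mul_assoc, hS h g k l h2, mul_zero, ite_self, ite_self]
    · rw [hR i j h g h1, zero_mul, ite_self, ite_self]
  have hl : ∑ h, ∑ g, (if R i h ∧ S h k then e i j * e h g * e k l else 0)
      = (#{h | R i h ∧ S h k} : ℂ) • (e i j * e k l) := by
    rw [Nat.cast_smul_eq_nsmul, ← Finset.sum_const, Finset.sum_filter]
    refine Finset.sum_congr rfl fun h _ => ?_
    split_ifs
    · exact he.sum_mid_row _ _ _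
    · exact Finset.sum_const_zero
  have hr : ∑ h, ∑ g, (if R j g ∧ S g l then e i j * e h g * e k l else 0)
      = (#{g | R j g ∧ S g l} : ℂ) • (e i j * e k l) := by
    rw [Nat.cast_smul_eq_nsmul, ← Finset.sum_const, Finset.sum_filter, Finset.sum_comm]
    refine Finset.sum_congr rfl fun g _ => ?_
    split_ifs
    · exact he.sum_mid_col _ _ _
    · exact Finset.sum_const_zero
  simp only [key] at hl
  rw [hr, ← sub_eq_zero, ← sub_smul, smul_eq_zero, sub_eq_zero, Nat.cast_inj] at hl
  exact hl.resolve_left hn.symm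

open Finset Classical in
theorem Respects.le_card (he : IsMagicUnitary e) (hR : Respects e R) (hS : Respects e S) (n : ℕ) :
    Respects e fun i k => n ≤ #{h | R i h ∧ S h k} :=
  fun _ _ _ _ hn => hR.mul_eq_zero_of_card_ne he hS fun h => hn (iff_of_eq (congrArg (n ≤ ·) h))

theorem Respects.reflTransGen (he : IsMagicUnitary e) (hR : Respects e R) :
    Respects e (Relation.ReflTransGen R) := by
  have key : ∀ {e : I → I → A}, IsMagicUnitary e → Respects e R → ∀ i k,
      Relation.ReflTransGen R i k → ∀ j l, ¬ Relation.ReflTransGen R j l →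
        e i j * e k l = 0 := by
    intro e he hR i k hik
    induction hik with
    | refl => exact fun j l hjl => he.row_mul i fun h => hjl (h ▸ .refl)
    | @tail h k _ hhk ih =>
      intro j l hjl
      -- Insert `∑ g, e h g = 1` at the last but one vertex of the path. Each `g` is either
      -- unreachable from `j`, where the induction hypothesis applies, or not `R`-related to `l`.
      rw [← he.sum_mid_row _ _ h]
      refine Finset.sum_eq_zero fun g _ => ?_
      by_cases hjg : Relation.ReflTransGen R j g
      · rw [mul_assoc, hR h g k l fun h' => hjl (hjg.tail (h'.1 hhk)), mul_zero]
      · rw [ih _ _ hjg, zero_mul]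
  intro i j k l hn
  by_cases hik : Relation.ReflTransGen R i k
  · exact key he hR i k hik j l fun hjl => hn (by tauto)
  -- A path on the column side becomes one on the row side for the transposed magic unitary.
  · exact key he.transpose hR.transpose j l (by tauto) i k hik

end IsMagicUnitary

/-! ### Twins and fibres -/

/-- There are two distinct vertices with the same neighbours. -/
def HasTwins {V : Type u} (X : SimpleGraph V) : Prop :=
  ∃ p q, p ≠ q ∧ ∀ z, X.Adj p z ↔ X.Adj q z

theorem IsVertexTransitive.compl {V : Type u} {X : SimpleGraph V} (h : IsVertexTransitive X) :
    IsVertexTransitive Xᶜ := fun p q => by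
  obtain ⟨f, hf⟩ := h p q
  exact ⟨⟨f.toEquiv, by simp [SimpleGraph.compl_adj, f.map_adj_iff]⟩, hf⟩

theorem IsVertexTransitive.not_hasTwins_compl {V : Type u} {X : SimpleGraph V}
    (h : IsVertexTransitive X) (hX : HasTwins X) : ¬ HasTwins Xᶜ := by
  rintro ⟨p, r, hpr, hr⟩
  obtain ⟨p', q', hpq', hq'⟩ := hX
  obtain ⟨f, rfl⟩ := h p' p
  have hq : ∀ z, X.Adj (f p') z ↔ X.Adj (f q') z := fun z => by
    obtain ⟨z, rfl⟩ := f.surjective z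
    rw [f.map_adj_iff, f.map_adj_iff, hq']
  have hpq : f p' ≠ f q' := fun h => hpq' (f.injective h)
  generalize f p' = p at *
  generalize f q' = q at *
  -- By transitivity, one vertex `p` has a twin `q` in `X` and a twin `r` in the complement. Twins
  -- are nonadjacent, so `r` is an `X`-neighbour of `p` and hence of `q`, while `q` is a complement
  -- neighbour of `p` and hence of `r`: a contradiction.
  have h1 : X.Adj p r := by
    by_contra hn
    have := (hr r).1 (by rw [SimpleGraph.compl_adj]; exact ⟨hpr, hn⟩)
    exact this.ne rfl
  have h2 : ¬ X.Adj p q := fun hn => ((hq q).1 hn).ne rfl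
  have h3 := (hr q).1 (by rw [SimpleGraph.compl_adj]; exact ⟨hpq, h2⟩)
  rw [SimpleGraph.compl_adj] at h3
  exact h3.2 ((hq r).1 h1).symm

theorem lex_compl {V : Type u} {W : Type v} (X : SimpleGraph V) (Y : SimpleGraph W) :
    (lex X Y)ᶜ = lex Xᶜ Yᶜ := by
  ext p q
  by_cases h : p.1 = q.1
  · simp [lex, SimpleGraph.compl_adj, Prod.ext_iff, h]
  · simp [lex, SimpleGraph.compl_adj, Prod.ext_iff, h]

section Fibre

variable {V : Type u} {W : Type v} [Fintype V] [Fintype W] {X : SimpleGraph V} {Y : SimpleGraph W}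
  {A : Type w} [CStarAlgebra A] {e : V × W → V × W → A}

open Finset Classical in
theorem IsVertexTransitive.exists_degree (h : IsVertexTransitive X) :
    ∃ k, ∀ p, #{z | X.Adj p z} = k := by
  rcases isEmpty_or_nonempty V with _ | ⟨⟨p⟩⟩
  · exact ⟨0, fun p => isEmptyElim p⟩
  · refine ⟨#{z | X.Adj p z}, fun q => ?_⟩
    obtain ⟨f, rfl⟩ := h p q
    refine (Finset.card_bij (fun z _ => f z) ?_ (fun _ _ _ _ h => f.injective h) ?_).symm
    · simp [f.map_adj_iff]
    · intro z hz
      obtain ⟨z, rfl⟩ := f.surjective z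
      exact ⟨z, by simpa [f.map_adj_iff] using hz, rfl⟩

theorem respects_fibre_of_not_hasTwins [Nonempty W] (hX : IsVertexTransitive X)
    (hT : ¬ HasTwins X) (he : IsMagicUnitary e) (hG : Respects e (lex X Y).Adj) :
    Respects e fun p q => p.1 = q.1 ∧ ¬ Y.Adj p.2 q.2 := by
  classical
  obtain ⟨k, hk⟩ := hX.exists_degree
  have hm : 0 < Fintype.card W := Fintype.card_pos
  -- The threshold is the size of all fibres over the neighbours of a vertex of `X`. Vertices of one
  -- fibre share all of these as neighbours; nonadjacent vertices of distinct fibres reach this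
  -- number only if they lie over twins.
  have h := hG.not.and (hG.le_card he hG (k * Fintype.card W))
  convert h using 3 with p q
  constructor
  · rintro ⟨h1, h2⟩
    refine ⟨?_, ?_⟩
    · rintro (h | h)
      · rw [h1] at h
        exact h.ne rfl
      · exact h2 h.2
    · rw [← hk p.1, ← Finset.card_univ, ← Finset.card_product]
      refine Finset.card_le_card fun z hz => ?_
      have hz : X.Adj p.1 z.1 := by simpa using hz
      simp only [Finset.mem_filter, Finset.mem_univ, true_and]
      exact ⟨Or.inl hz, Or.inl (h1 ▸ hz.symm)⟩
  · rintro ⟨h1, h2⟩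
    have hpq : p.1 = q.1 := by
      by_contra hne
      -- A common neighbour inside the fibre of `p` or of `q` would make `p.1` and `q.1` adjacent or
      -- equal, so all common neighbours lie over common neighbours in `X`.
      have hsub : ({h | (lex X Y).Adj p h ∧ (lex X Y).Adj h q} : Finset (V × W)) ⊆
          ({z | X.Adj p.1 z ∧ X.Adj q.1 z} : Finset V) ×ˢ Finset.univ := by
        intro z hz
        simp only [Finset.mem_filter, Finset.mem_univ, true_and] at hz
        simp only [Finset.mem_product, Finset.mem_filter, Finset.mem_univ, true_and, and_true]
        have hna : ¬ X.Adj p.1 q.1 := fun h => h1 (Or.inl h)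
        rcases hz with ⟨hz1 | hz1, hz2 | hz2⟩
        · exact ⟨hz1, hz2.symm⟩
        · exact absurd (hz2.1 ▸ hz1) hna
        · exact absurd (hz1.1 ▸ hz2) hna
        · exact absurd (hz1.1.trans hz2.1) hne
      have hle := h2.trans (Finset.card_le_card hsub)
      rw [Finset.card_product, Finset.card_univ] at hle
      have hle := Nat.le_of_mul_le_mul_right hle hm
      have hp : ({z | X.Adj p.1 z ∧ X.Adj q.1 z} : Finset V) = ({z | X.Adj p.1 z} : Finset V) :=
        Finset.eq_of_subset_of_card_le (fun z hz => by simp at hz ⊢; exact hz.1)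
          ((hk p.1).trans_le hle)
      have hq : ({z | X.Adj p.1 z ∧ X.Adj q.1 z} : Finset V) = ({z | X.Adj q.1 z} : Finset V) :=
        Finset.eq_of_subset_of_card_le (fun z hz => by simp at hz ⊢; exact hz.2)
          ((hk q.1).trans_le hle)
      refine hT ⟨p.1, q.1, hne, fun z => ?_⟩
      have := Finset.ext_iff.1 (hp.symm.trans hq) z
      simpa using this
    exact ⟨hpq, fun h => h1 (Or.inr ⟨hpq, h⟩)⟩

/-- Nonadjacency inside a fibre is a respected relation, and a path in the complement of `Y` links
any two vertices of the fibre by it. -/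
theorem respects_fibre_of_preconnected [Nonempty W] (hX : IsVertexTransitive X)
    (hT : ¬ HasTwins X) (hY : Yᶜ.Preconnected) (he : IsMagicUnitary e)
    (hG : Respects e (lex X Y).Adj) : Respects e fun p q => p.1 = q.1 := by
  have h := (respects_fibre_of_not_hasTwins hX hT he hG).reflTransGen he
  convert h using 3 with p q
  constructor
  · obtain ⟨x, y⟩ := p
    obtain ⟨x', z⟩ := q
    rintro rfl
    have hyz := (SimpleGraph.reachable_iff_reflTransGen y z).1 (hY y z)
    refine hyz.lift (fun y => (x, y)) fun a b hab => ⟨rfl, ?_⟩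
    rw [SimpleGraph.compl_adj] at hab
    exact hab.2
  · intro h
    induction h with
    | refl => rfl
    | tail _ h ih => exact ih.trans h.1

/-- Under Sabidussi's conditions, the fibres of `X[Y]` are preserved. -/
theorem respects_fibre [Nonempty W] (hX : IsVertexTransitive X)
    (h1 : HasTwins X → Y.Preconnected) (h2 : HasTwins Xᶜ → Yᶜ.Preconnected)
    (he : IsMagicUnitary e) (hG : Respects e (lex X Y).Adj) :
    Respects e fun p q => p.1 = q.1 := by
  have hG' : Respects e (lex Xᶜ Yᶜ).Adj := lex_compl X Y ▸ hG.compl he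
  by_cases hT : HasTwins X
  · exact respects_fibre_of_preconnected hX.compl (hX.not_hasTwins_compl hT)
      ((compl_compl Y).symm ▸ h1 hT) he hG'
  · by_cases hT' : HasTwins Xᶜ
    · exact respects_fibre_of_preconnected hX hT (h2 hT') he hG
    -- Without twins on either side no connectedness is needed: nonadjacency in `Y` and nonadjacency
    -- in its complement together exhaust the pairs inside a fibre.
    · have h := (respects_fibre_of_not_hasTwins hX hT he hG).or
        (respects_fibre_of_not_hasTwins hX.compl hT' he hG')
      convert h using 3 with p q
      rw [SimpleGraph.compl_adj]
      tauto

/-! ### The magic unitaries on the fibres and on their set -/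

/-- The sum of a row over a fibre. -/
def fibreRow (e : V × W → V × W → A) (y : W) (p q : V) : A := ∑ z, e (p, y) (q, z)

omit [Fintype V] in
theorem fibreRow_mul_of_ne (hE : Respects e fun p q => p.1 = q.1) {y z : W} {p p' q q' : V}
    (h : ¬ (p = p' ↔ q = q')) : fibreRow e y p q * fibreRow e z p' q' = 0 := by
  rw [fibreRow, fibreRow, Finset.sum_mul_sum]
  exact Finset.sum_eq_zero fun _ _ => Finset.sum_eq_zero fun _ _ => hE _ _ _ _ h

theorem sum_fibreRow (he : IsMagicUnitary e) (y : W) (p : V) : ∑ q, fibreRow e y p q = 1 := by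
  rw [← he.row_sum (p, y), Fintype.sum_prod_type]
  rfl

theorem fibreRow_eq_mul (he : IsMagicUnitary e) (hE : Respects e fun p q => p.1 = q.1) (y z : W)
    (p q : V) : fibreRow e y p q * fibreRow e z p q = fibreRow e y p q := by
  conv_rhs => rw [← mul_one (fibreRow e y p q), ← sum_fibreRow he z p, Finset.mul_sum]
  exact (Fintype.sum_eq_single (f := fun q' => fibreRow e y p q * fibreRow e z p q') q
    fun q' hq' => fibreRow_mul_of_ne hE (by simp [hq'.symm])).symm

theorem fibreRow_eq_mul' (he : IsMagicUnitary e) (hE : Respects e fun p q => p.1 = q.1) (y z : W)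
    (p q : V) : fibreRow e y p q * fibreRow e z p q = fibreRow e z p q := by
  conv_rhs => rw [← one_mul (fibreRow e z p q), ← sum_fibreRow he y p, Finset.sum_mul]
  exact (Fintype.sum_eq_single (f := fun q' => fibreRow e y p q' * fibreRow e z p q) q
    fun q' hq' => fibreRow_mul_of_ne hE (by simp [hq'])).symm

/-- The product of the two sums equals each of them: when `1` is expanded as the sum over all target
fibres, only the term with the same target survives. -/
theorem fibreRow_eq (he : IsMagicUnitary e) (hE : Respects e fun p q => p.1 = q.1) (y z : W)
    (p q : V) : fibreRow e y p q = fibreRow e z p q :=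
  (fibreRow_eq_mul he hE y z p q).symm.trans (fibreRow_eq_mul' he hE y z p q)

/-- A block has constant row sums and constant column sums. Both, multiplied by `|W|`, give the sum
of the whole block, so they agree. -/
theorem fibreRow_transpose (he : IsMagicUnitary e) (hE : Respects e fun p q => p.1 = q.1) (y z : W)
    (p q : V) : fibreRow (fun i j => e j i) y q p = fibreRow e z p q := by
  have hm : (Fintype.card W : ℂ) ≠ 0 := by
    have : Nonempty W := ⟨y⟩
    exact_mod_cast Fintype.card_ne_zero
  refine smul_right_injective A hm ?_
  change (Fintype.card W : ℂ) • _ = (Fintype.card W : ℂ) • _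
  rw [Nat.cast_smul_eq_nsmul, Nat.cast_smul_eq_nsmul, ← Finset.card_univ, ← Finset.sum_const,
    ← Finset.sum_const, Finset.sum_congr rfl fun z' _ =>
      fibreRow_eq he.transpose hE.transpose y z' q p,
    Finset.sum_congr rfl fun z' _ => fibreRow_eq he hE z z' p q]
  exact Finset.sum_comm

theorem fibreRow_magic (he : IsMagicUnitary e) (hE : Respects e fun p q => p.1 = q.1) (y : W) :
    IsMagicUnitary (fibreRow e y) where
  idem p q := fibreRow_eq_mul he hE y y p q
  selfAdj p q := by
    rw [fibreRow, star_sum]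
    exact Finset.sum_congr rfl fun z _ => he.selfAdj _ _
  row_sum := sum_fibreRow he y
  col_sum q := by
    rw [← sum_fibreRow he.transpose y q]
    exact Finset.sum_congr rfl fun p _ => (fibreRow_transpose he hE y y p q).symm

omit [Fintype V] in
theorem fibreRow_respects (hE : Respects e fun p q => p.1 = q.1)
    (hG : Respects e (lex X Y).Adj) (y : W) : Respects (fibreRow e y) X.Adj := by
  intro p q p' q' h
  by_cases hpq : p = p' ↔ q = q'
  · rw [fibreRow, fibreRow, Finset.sum_mul_sum]
    refine Finset.sum_eq_zero fun z _ => Finset.sum_eq_zero fun z' _ => hG _ _ _ _ fun h' => h ?_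
    by_cases hp : p = p'
    · obtain rfl := hp
      obtain rfl := hpq.1 rfl
      simp
    · have hq : q ≠ q' := fun hq => hp (hpq.2 hq)
      simpa [lex, hp, hq] using h'
  · exact fibreRow_mul_of_ne hE hpq

/-- The action on the fibre of `p`. -/
def fibreEntry (e : V × W → V × W → A) (p : V) (y z : W) : A := ∑ q, e (p, y) (q, z)

/-- The two sums run along the same row of `e` and share only the entry at `(q, z)`, so
orthogonality leaves that entry. With the reversed product below, this yields the commutation
relation of the free wreath product. -/
theorem fibreEntry_mul_fibreRow (he : IsMagicUnitary e) (p q : V) (y z : W) :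
    fibreEntry e p y z * fibreRow e y p q = e (p, y) (q, z) := by
  rw [fibreEntry, fibreRow, Finset.sum_mul_sum, Fintype.sum_eq_single q, Fintype.sum_eq_single z,
    he.idem]
  · exact fun z' hz' => he.row_mul _ (by simp [hz'.symm])
  · exact fun q' hq' => Finset.sum_eq_zero fun z' _ => he.row_mul _ (by simp [hq'])

theorem fibreRow_mul_fibreEntry (he : IsMagicUnitary e) (p q : V) (y z : W) :
    fibreRow e y p q * fibreEntry e p y z = e (p, y) (q, z) := by
  rw [fibreEntry, fibreRow, Finset.sum_mul_sum, Fintype.sum_eq_single z, Fintype.sum_eq_single q,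
    he.idem]
  · exact fun q' hq' => he.row_mul _ (by simp [hq'.symm])
  · exact fun z' hz' => Finset.sum_eq_zero fun q' _ => he.row_mul _ (by simp [hz'])

theorem fibreEntry_magic (he : IsMagicUnitary e) (hE : Respects e fun p q => p.1 = q.1) (p : V) :
    IsMagicUnitary (fibreEntry e p) where
  idem y z := by
    conv_lhs => enter [2]; rw [fibreEntry]
    conv_rhs => rw [fibreEntry]
    rw [Finset.mul_sum]
    refine Finset.sum_congr rfl fun q _ => ?_
    rw [fibreEntry, Finset.sum_mul, Fintype.sum_eq_single q, he.idem]
    exact fun q' hq' => he.row_mul _ (by simp [hq'])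
  selfAdj y z := by
    rw [fibreEntry, star_sum]
    exact Finset.sum_congr rfl fun q _ => he.selfAdj _ _
  row_sum y := by
    rw [← he.row_sum (p, y), Fintype.sum_prod_type, Finset.sum_comm]
    rfl
  col_sum z := by
    rw [← sum_fibreRow he z p]
    simp only [fibreEntry]
    rw [Finset.sum_comm]
    exact Finset.sum_congr rfl fun q _ => fibreRow_transpose he hE z z p q

omit [Fintype W] in
theorem fibreEntry_respects (hE : Respects e fun p q => p.1 = q.1)
    (hG : Respects e (lex X Y).Adj) (p : V) : Respects (fibreEntry e p) Y.Adj := by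
  intro y z y' z' h
  rw [fibreEntry, fibreEntry, Finset.sum_mul_sum]
  refine Finset.sum_eq_zero fun q _ => Finset.sum_eq_zero fun q' _ => ?_
  by_cases hq : q = q'
  · subst hq
    exact hG _ _ _ _ fun h' => h (by simpa [lex] using h')
  · exact hE _ _ _ _ (by simp [hq])

end Fibre

/-! ### The quantum Sabidussi theorem -/

theorem freeWreath_respects {V : Type u} {W : Type v} [Fintype V] [Fintype W]
    (X : SimpleGraph V) (Y : SimpleGraph W) :
    Respects (wreathEntry (Qut Y) (Qut X)) (lex X Y).Adj := by
  rintro ⟨p, y⟩ ⟨q, z⟩ ⟨p', y'⟩ ⟨q', z'⟩ h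
  have hX : ¬ (X.Adj p p' ↔ X.Adj q q') ∨ ¬ (p = p' ↔ q = q') →
      (Qut X).e p q * (Qut X).e p' q' = 0 := by
    rintro (h | h)
    · exact Qut_respects X _ _ _ _ h
    · by_cases hp : p = p'
      · subst hp
        exact (Qut X).magic.row_mul p fun hq => h (by simp [hq])
      · by_cases hq : q = q'
        · subst hq
          exact (Qut X).magic.col_mul q hp
        · exact absurd (by simp [hp, hq]) h
  unfold wreathEntry
  -- After commuting, the two entries of `Qut X` become neighbours, and their product vanishes
  -- unless adjacency in `X` and equality of base points both agree. If they do, a disagreement in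
  -- `X[Y]` can only occur inside a fibre, where it is a disagreement in `Y`.
  by_cases hpq : ¬ (X.Adj p p' ↔ X.Adj q q') ∨ ¬ (p = p' ↔ q = q')
  · rw [wreath_comm _ _ y' z' p' q', mul_assoc, ← mul_assoc (wreathH _ _ _) (wreathH _ _ _),
      ← map_mul, hX hpq, map_zero, zero_mul, mul_zero]
  · push Not at hpq
    by_cases hp : p = p'
    · obtain rfl := hp
      obtain rfl := hpq.2.1 rfl
      rw [wreath_comm _ _ y z p q, mul_assoc, ← mul_assoc (wreathG _ _ _ _) (wreathG _ _ _ _),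
        ← map_mul, Qut_respects Y y z y' z' (by simpa [lex] using h), map_zero, zero_mul, mul_zero]
    · exact absurd (by simp [lex, hp, mt hpq.2.2 hp, hpq.1]) h

/-- The quantum version of Sabidussi's theorem: under Sabidussi's conditions, the quantum
automorphism group of a lexicographic product is the free wreath product. -/
theorem Qut_lex {V : Type u} {W : Type v} [Fintype V] [Fintype W] [Nonempty W]
    {X : SimpleGraph V} {Y : SimpleGraph W} (hX : IsVertexTransitive X)
    (h1 : HasTwins X → Y.Preconnected) (h2 : HasTwins Xᶜ → Yᶜ.Preconnected) :
    (Qut (lex X Y)).Eq (freeWreath (Qut Y) (Qut X)) := by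
  obtain ⟨φ, hφ⟩ := exists_Qut_hom (lex X Y) (wreathEntry_magic (Qut Y) (Qut X))
    (freeWreath_respects X Y)
  have he := (Qut (lex X Y)).magic
  have hG := Qut_respects (lex X Y)
  have hE := respects_fibre hX h1 h2 he hG
  let y₀ : W := Classical.arbitrary W
  choose ψG hψG using fun p => exists_Qut_hom Y (fibreEntry_magic he hE p)
    (fibreEntry_respects hE hG p)
  obtain ⟨ψH, hψH⟩ := exists_Qut_hom X (fibreRow_magic he hE y₀) (fibreRow_respects hE hG y₀)
  obtain ⟨θ, hθ⟩ := exists_freeWreath_hom ψG ψH fun y z p q => by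
    rw [hψG, hψH, fibreRow_eq he hE y₀ y, fibreEntry_mul_fibreRow he, fibreRow_mul_fibreEntry he]
  refine QPG.EqVia.of_homs _ (Qut_generates _)
    (freeWreath_generates (Qut_generates _) (Qut_generates _)) φ hφ θ fun p q => ?_
  refine (hθ p q).trans ?_
  rw [hψG, hψH, fibreRow_eq he hE y₀ p.2, fibreEntry_mul_fibreRow he]

/-! ### Isomorphisms of lexicographic products -/

/-- An isomorphism of graphs is also one of their complements. -/
def complIso {V : Type u} {W : Type v} {X : SimpleGraph V} {Y : SimpleGraph W} (f : X ≃g Y) :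
    Xᶜ ≃g Yᶜ where
  toEquiv := f.toEquiv
  map_rel_iff' := by simp [SimpleGraph.compl_adj, f.map_adj_iff]

/-- Isomorphic factors give isomorphic lexicographic products. -/
def lexCongr {V V' W W' : Type*} {X : SimpleGraph V} {X' : SimpleGraph V'} {Y : SimpleGraph W}
    {Y' : SimpleGraph W'} (f : X ≃g X') (g : Y ≃g Y') : lex X Y ≃g lex X' Y' where
  toEquiv := f.toEquiv.prodCongr g.toEquiv
  map_rel_iff' := by simp [lex, f.map_adj_iff, g.map_adj_iff]

/-- The lexicographic product is associative. -/
def lexAssoc {U V W : Type*} (X : SimpleGraph U) (Y : SimpleGraph V) (Z : SimpleGraph W) :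
    lex (lex X Y) Z ≃g lex X (lex Y Z) where
  toEquiv := Equiv.prodAssoc U V W
  map_rel_iff' := by
    simp only [lex, Equiv.prodAssoc_apply, Prod.forall, Prod.mk.injEq]
    tauto

/-- A lexicographic product of edgeless graphs is edgeless. -/
def lexEdgeless (a b : ℕ) : lex (edgelessG a) (edgelessG b) ≃g edgelessG (a * b) where
  toEquiv := finProdFinEquiv
  map_rel_iff' := by simp [lex]

/-- A factorization `X = X'[K_a]` gives one of the complements. -/
def complLexComplete {V V' : Type*} {X : SimpleGraph V} {X' : SimpleGraph V'} {a : ℕ}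
    (f : X ≃g lex X' (completeG a)) : Xᶜ ≃g lex X'ᶜ (edgelessG a) where
  toEquiv := f.toEquiv
  map_rel_iff' := fun {p q} => by
    have h : (lex X'ᶜ (edgelessG a)) = (lex X' (completeG a))ᶜ := by rw [lex_compl, completeG, compl_top]
    rw [h]
    exact (complIso f).map_rel_iff'

/-- A factorization `Y = K_b[Y']` gives one of the complements. -/
def complCompleteLex {W W' : Type*} {Y : SimpleGraph W} {Y' : SimpleGraph W'} {b : ℕ}
    (g : Y ≃g lex (completeG b) Y') : Yᶜ ≃g lex (edgelessG b) Y'ᶜ where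
  toEquiv := g.toEquiv
  map_rel_iff' := fun {p q} => by
    have h : (lex (edgelessG b) Y'ᶜ) = (lex (completeG b) Y')ᶜ := by rw [lex_compl, completeG, compl_top]
    rw [h]
    exact (complIso g).map_rel_iff'

theorem lex_complete_of_compl {V V' : Type*} {X : SimpleGraph V} {X' : SimpleGraph V'} {a : ℕ}
    (h : Nonempty (Xᶜ ≃g lex X' (edgelessG a))) : Nonempty (X ≃g lex X'ᶜ (completeG a)) := by
  obtain ⟨f⟩ := h
  have f' := complIso f
  rw [lex_compl, compl_compl, show (edgelessG a)ᶜ = completeG a from compl_bot] at f'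
  exact ⟨f'⟩

theorem complete_lex_of_compl {W W' : Type*} {Y : SimpleGraph W} {Y' : SimpleGraph W'} {b : ℕ}
    (h : Nonempty (Yᶜ ≃g lex (edgelessG b) Y')) : Nonempty (Y ≃g lex (completeG b) Y'ᶜ) := by
  obtain ⟨f⟩ := h
  have f' := complIso f
  rw [lex_compl, compl_compl, show (edgelessG b)ᶜ = completeG b from compl_bot] at f'
  exact ⟨f'⟩

/-- `X[Y] = X'[L_{αβ}[Y']]` for `X = X'[L_α]` and `Y = L_β[Y']`. -/
def regroupIso {V V' W W' : Type u} {X : SimpleGraph V} {X' : SimpleGraph V'} {Y : SimpleGraph W}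
    {Y' : SimpleGraph W'} {α β : ℕ} (f : X ≃g lex X' (edgelessG α))
    (g : Y ≃g lex (edgelessG β) Y') :
    lex X Y ≃g lex X' (lex (edgelessG (α * β)) Y') where
  toEquiv := regroup f.toEquiv g.toEquiv
  map_rel_iff' := fun {p q} => by
    have hf : X.Adj p.1 q.1 ↔ X'.Adj (f p.1).1 (f q.1).1 := by
      rw [← f.map_adj_iff]
      simp [lex]
    have hg : Y.Adj p.2 q.2 ↔ (g p.2).1 = (g q.2).1 ∧ Y'.Adj (g p.2).2 (g q.2).2 := by
      rw [← g.map_adj_iff]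
      simp [lex]
    have hpq : p.1 = q.1 ↔ (f p.1).1 = (f q.1).1 ∧ (f p.1).2 = (f q.1).2 := by
      rw [← Prod.ext_iff, f.injective.eq_iff]
    change (X'.Adj (f p.1).1 (f q.1).1 ∨ (f p.1).1 = (f q.1).1 ∧
      (False ∨ finProdFinEquiv ((f p.1).2, (g p.2).1) = finProdFinEquiv ((f q.1).2, (g q.2).1) ∧
        Y'.Adj (g p.2).2 (g q.2).2)) ↔ X.Adj p.1 q.1 ∨ p.1 = q.1 ∧ Y.Adj p.2 q.2
    rw [hf, hg, hpq, finProdFinEquiv.injective.eq_iff, Prod.mk.injEq]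
    tauto

/-! ### Factorizations of vertex-transitive graphs -/

/-- The equivalence relation of being twins. -/
def twinSetoid {V : Type u} (X : SimpleGraph V) : Setoid V where
  r p q := ∀ z, X.Adj p z ↔ X.Adj q z
  iseqv := ⟨fun _ _ => Iff.rfl, fun h z => (h z).symm, fun h h' z => (h z).trans (h' z)⟩

/-- The graph on the classes of twins. -/
def twinQuotient {V : Type u} (X : SimpleGraph V) : SimpleGraph (Quotient (twinSetoid X)) where
  Adj := Quotient.lift₂ X.Adj fun p q p' q' (hp : ∀ z, _) (hq : ∀ z, _) => by
    rw [eq_iff_iff, hp, X.adj_comm, hq, X.adj_comm]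
  symm := ⟨by
    rintro ⟨p⟩ ⟨q⟩ h
    exact X.symm.symm _ _ h⟩
  loopless := ⟨by
    rintro ⟨p⟩ h
    exact X.loopless.irrefl p h⟩

theorem twin_map {V : Type u} {X : SimpleGraph V} (f : X ≃g X) (p q : V) :
    (∀ z, X.Adj (f p) z ↔ X.Adj (f q) z) ↔ ∀ z, X.Adj p z ↔ X.Adj q z := by
  rw [← f.toEquiv.forall_congr_right (q := fun z => X.Adj (f p) z ↔ X.Adj (f q) z)]
  refine forall_congr' fun z => ?_
  exact iff_congr f.map_adj_iff f.map_adj_iff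

/-- The isomorphism of the twin quotient given by an automorphism. -/
def twinQuotientMap {V : Type u} {X : SimpleGraph V} (f : X ≃g X) :
    twinQuotient X ≃g twinQuotient X where
  toEquiv := Quotient.congr f.toEquiv fun p q => (twin_map f p q).symm
  map_rel_iff' := by
    rintro ⟨p⟩ ⟨q⟩
    exact f.map_adj_iff

theorem IsVertexTransitive.twinQuotient {V : Type u} {X : SimpleGraph V}
    (h : IsVertexTransitive X) : IsVertexTransitive (twinQuotient X) := by
  rintro ⟨p⟩ ⟨q⟩
  obtain ⟨f, rfl⟩ := h p q
  exact ⟨twinQuotientMap f, rfl⟩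

/-- Automorphisms permute the twin classes, so these have a common size `α`. Adjacency depends only
on the classes and twins are nonadjacent, so `X` is the blow-up of its twin quotient. -/
theorem exists_lex_edgeless_of_hasTwins {V : Type u} [Fintype V] {X : SimpleGraph V}
    (hX : IsVertexTransitive X) (hT : HasTwins X) :
    ∃ (α : ℕ) (V' : Type u) (_ : Fintype V') (X' : SimpleGraph V'), 1 < α ∧
      IsVertexTransitive X' ∧ Nonempty (X ≃g lex X' (edgelessG α)) := by
  classical
  obtain ⟨p, q, hpq, hT⟩ := hT
  let π : V → Quotient (twinSetoid X) := Quotient.mk (twinSetoid X)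
  let α := Fintype.card {z // π z = π p}
  have hcard : ∀ c, Fintype.card {z // π z = c} = α := by
    intro c
    obtain ⟨r, rfl⟩ : ∃ r, π r = c := Quotient.exists_rep c
    obtain ⟨f, rfl⟩ := hX p r
    refine (Fintype.card_congr (f.toEquiv.subtypeEquiv fun z => ?_)).symm
    have hπ : ∀ a b, π a = π b ↔ ∀ z, X.Adj a z ↔ X.Adj b z := fun a b => Quotient.eq
    rw [hπ, ← twin_map f, ← hπ]
    rfl
  let E : V ≃ Quotient (twinSetoid X) × Fin α :=
    (Equiv.sigmaFiberEquiv π).symm.trans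
      ((Equiv.sigmaCongrRight fun c => Fintype.equivFinOfCardEq (hcard c)).trans
        (Equiv.sigmaEquivProd _ _))
  refine ⟨α, Quotient (twinSetoid X), inferInstance, twinQuotient X, ?_, hX.twinQuotient,
    ⟨⟨E, fun {a b} => ?_⟩⟩⟩
  · refine Fintype.one_lt_card_iff.2 ⟨⟨p, rfl⟩, ⟨q, ?_⟩, fun h => hpq (congrArg Subtype.val h)⟩
    exact Quotient.sound fun z => (hT z).symm
  · change (X.Adj a b ∨ _ ∧ False) ↔ X.Adj a b
    simp

/-- By transitivity, every component is carried onto the component of `p` by some automorphism;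
choosing one for each component gives product coordinates on `W`. -/
theorem exists_edgeless_lex_of_not_preconnected {W : Type u} [Fintype W] {Y : SimpleGraph W}
    (hY : IsVertexTransitive Y) (hC : ¬ Y.Preconnected) :
    ∃ (β : ℕ) (W' : Type u) (_ : Fintype W') (Y' : SimpleGraph W'), 1 < β ∧
      IsVertexTransitive Y' ∧ Nonempty (Y ≃g lex (edgelessG β) Y') := by
  classical
  unfold SimpleGraph.Preconnected at hC
  push Not at hC
  obtain ⟨p, q, hpq⟩ := hC
  have hreach : ∀ (f : Y ≃g Y) {a b}, Y.Reachable a b → Y.Reachable (f a) (f b) :=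
    fun f _ _ h => h.map f.toHom
  choose F hF using fun c : Y.ConnectedComponent => hY c.out p
  let n := Fintype.card Y.ConnectedComponent
  let ν : Y.ConnectedComponent ≃ Fin n := Fintype.equivFin _
  let mk := Y.connectedComponentMk
  have hout : ∀ a, Y.Reachable (mk a).out a := fun a =>
    SimpleGraph.ConnectedComponent.exact (Quot.out_eq (mk a))
  have hp : ∀ a, Y.Reachable p (F (mk a) a) := fun a => by
    have := hreach (F (mk a)) (hout a)
    rwa [hF] at this
  have hinv : ∀ c b, Y.Reachable p b → mk ((F c).symm b) = c := fun c b hb => by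
    have := hreach (F c).symm hb
    rw [← hF c, RelIso.symm_apply_apply] at this
    exact (SimpleGraph.ConnectedComponent.sound this).symm.trans (Quot.out_eq c)
  let E : W ≃ Fin n × {b // Y.Reachable p b} :=
    { toFun := fun a => (ν (mk a), ⟨F (mk a) a, hp a⟩)
      invFun := fun b => (F (ν.symm b.1)).symm b.2
      left_inv := fun a => by simp
      right_inv := fun b => by
        obtain ⟨i, b, hb⟩ := b
        have h := hinv (ν.symm i) b hb
        refine Prod.ext ?_ (Subtype.ext ?_)
        · simp only [h, Equiv.apply_symm_apply]
        · simp only [h, RelIso.apply_symm_apply] }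
  refine ⟨n, {b // Y.Reachable p b}, inferInstance, Y.induce {b | Y.Reachable p b}, ?_, ?_,
    ⟨⟨E, fun {a b} => ?_⟩⟩⟩
  · exact Fintype.one_lt_card_iff.2 ⟨mk p, mk q, fun h =>
      hpq (SimpleGraph.ConnectedComponent.exact h)⟩
  · rintro ⟨a, ha⟩ ⟨b, hb⟩
    obtain ⟨f, rfl⟩ := hY a b
    have hf : ∀ z, Y.Reachable p z ↔ Y.Reachable p (f z) := fun z => by
      constructor
      · intro hz
        exact hb.trans (hreach f (ha.symm.trans hz))
      · intro hz
        have := hreach f.symm (hb.symm.trans hz)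
        rw [RelIso.symm_apply_apply, RelIso.symm_apply_apply] at this
        exact ha.trans this
    exact ⟨⟨f.toEquiv.subtypeEquiv hf, f.map_adj_iff⟩, rfl⟩
  · change (False ∨ ν (mk a) = ν (mk b) ∧ Y.Adj (F (mk a) a) (F (mk b) b)) ↔ Y.Adj a b
    rw [ν.injective.eq_iff, false_or]
    constructor
    · rintro ⟨h, h'⟩
      rw [h] at h'
      exact (F (mk b)).map_adj_iff.1 h'
    · intro h
      have hab : mk a = mk b := SimpleGraph.ConnectedComponent.sound h.reachable
      rw [hab]
      exact ⟨rfl, (F (mk b)).map_adj_iff.2 h⟩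

/-! ### The quantum automorphism group for maximal factorizations -/

theorem isVertexTransitive_bot (V : Type u) : IsVertexTransitive (⊥ : SimpleGraph V) := by
  classical
  exact fun p q => ⟨⟨Equiv.swap p q, by simp⟩, Equiv.swap_apply_left p q⟩

theorem not_hasTwins_top (V : Type u) : ¬ HasTwins (⊤ : SimpleGraph V) := by
  rintro ⟨p, q, hpq, h⟩
  exact ((h q).1 (by simpa using hpq)).ne rfl

theorem lex_top_preconnected {V : Type u} {W : Type v} [Nontrivial V] (Y : SimpleGraph W) :
    (lex (⊤ : SimpleGraph V) Y).Preconnected := by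
  have hadj : ∀ p q : V × W, p.1 ≠ q.1 → (lex (⊤ : SimpleGraph V) Y).Reachable p q :=
    fun p q h => SimpleGraph.Adj.reachable (Or.inl (by simpa using h))
  intro p q
  obtain ⟨r, hr⟩ := exists_ne p.1
  by_cases h : p.1 = q.1
  · exact (hadj p (r, p.2) hr.symm).trans (hadj _ q (h ▸ hr))
  · exact hadj p q h

section Maximal

variable {V V' W W' : Type u} [Fintype V'] [Fintype W']
  {X : SimpleGraph V} {X' : SimpleGraph V'} {Y : SimpleGraph W} {Y' : SimpleGraph W'} {α β : ℕ}

/-- Twins in `X'` would split off a further edgeless factor on `c > 1` vertices, which associativity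
merges into one on `c * α` vertices. -/
theorem not_hasTwins_of_maximal (hα : 1 < α) (hX' : IsVertexTransitive X')
    (f : X ≃g lex X' (edgelessG α))
    (hmax : ∀ (a : ℕ) (U : Type u) [Fintype U] (Z : SimpleGraph U), IsVertexTransitive Z →
      Nonempty (X ≃g lex Z (edgelessG a)) → a ≤ α) : ¬ HasTwins X' := by
  intro hT
  obtain ⟨c, U, _, Z, hc, hZ, ⟨g⟩⟩ := exists_lex_edgeless_of_hasTwins hX' hT
  have h := hmax (c * α) U Z hZ ⟨f.trans ((lexCongr g .refl).trans
    ((lexAssoc Z (edgelessG c) (edgelessG α)).trans (lexCongr .refl (lexEdgeless c α))))⟩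
  nlinarith

theorem preconnected_of_maximal (hβ : 1 < β) (hY' : IsVertexTransitive Y')
    (g : Y ≃g lex (edgelessG β) Y')
    (hmax : ∀ (b : ℕ) (U : Type u) [Fintype U] (Z : SimpleGraph U), IsVertexTransitive Z →
      Nonempty (Y ≃g lex (edgelessG b) Z) → b ≤ β) : Y'.Preconnected := by
  by_contra hC
  obtain ⟨c, U, _, Z, hc, hZ, ⟨f⟩⟩ := exists_edgeless_lex_of_not_preconnected hY' hC
  have h := hmax (β * c) U Z hZ ⟨g.trans ((lexCongr .refl f).trans
    ((lexAssoc (edgelessG β) (edgelessG c) Z).symm.trans (lexCongr (lexEdgeless β c) .refl)))⟩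
  nlinarith

variable [Fintype V] [Fintype W]

theorem Qut_lex_eqVia_of_maximal [Nonempty W] (hα : 1 < α) (hβ : 1 < β)
    (hX' : IsVertexTransitive X') (hY' : IsVertexTransitive Y')
    (f : X ≃g lex X' (edgelessG α)) (g : Y ≃g lex (edgelessG β) Y')
    (hmaxX : ∀ (a : ℕ) (U : Type u) [Fintype U] (Z : SimpleGraph U), IsVertexTransitive Z →
      Nonempty (X ≃g lex Z (edgelessG a)) → a ≤ α)
    (hmaxY : ∀ (b : ℕ) (U : Type u) [Fintype U] (Z : SimpleGraph U), IsVertexTransitive Z →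
      Nonempty (Y ≃g lex (edgelessG b) Z) → b ≤ β) :
    (Qut (lex X Y)).EqVia
      (freeWreath (freeWreath (Qut Y') (quantumSymmetric (Fin (α * β)))) (Qut X'))
      (regroup f.toEquiv g.toEquiv) := by
  have : Nonempty W' := ‹Nonempty W›.map fun y => (g y).2
  have hαβ : 1 < α * β := by nlinarith
  have : Nontrivial (Fin (α * β)) := Fin.nontrivial_iff_two_le.2 hαβ
  have : Nonempty (Fin (α * β) × W') := ⟨(⟨0, by omega⟩, Classical.arbitrary W')⟩
  have hZ : (Qut (lex (edgelessG (α * β)) Y')).Eq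
      (freeWreath (Qut Y') (quantumSymmetric (Fin (α * β)))) := by
    rw [← Qut_bot]
    -- The edgeless base has twins, so connectedness of `Y'` is essential here; its complement, a
    -- complete graph, has none.
    refine Qut_lex (isVertexTransitive_bot _)
      (fun _ => preconnected_of_maximal hβ hY' g hmaxY) fun h => ?_
    rw [compl_bot] at h
    exact absurd h (not_hasTwins_top _)
  have h1 := Qut_eqVia_of_iso (regroupIso f g)
  -- Here `X'` has no twins by maximality of `α`. The complement of the inner factor is a product
  -- with a complete base on more than one vertex, hence connected, so twins in the complement of
  -- `X'` are harmless.
  have h2 : (Qut (lex X' (lex (edgelessG (α * β)) Y'))).Eq _ := Qut_lex hX'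
    (fun h => absurd h (not_hasTwins_of_maximal hα hX' f hmaxX)) fun _ => by
      rw [lex_compl, compl_bot]
      exact lex_top_preconnected _
  have h3 := freeWreath_congr (Qut_generates _)
    (freeWreath_generates (Qut_generates Y') (universalQPG_generates (Fin (α * β)) ∅))
    (Qut_generates X') (Qut_generates X') hZ (⟨StarAlgEquiv.refl _ _, fun _ _ => rfl⟩)
  exact (h1.trans (h2.trans h3)).of_eq (Equiv.ext fun _ => rfl)

theorem Qut_lex_eqVia_of_maximal_complete [Nonempty W] (hα : 1 < α) (hβ : 1 < β)
    (hX' : IsVertexTransitive X') (hY' : IsVertexTransitive Y')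
    (f : X ≃g lex X' (completeG α)) (g : Y ≃g lex (completeG β) Y')
    (hmaxX : ∀ (a : ℕ) (U : Type u) [Fintype U] (Z : SimpleGraph U), IsVertexTransitive Z →
      Nonempty (X ≃g lex Z (completeG a)) → a ≤ α)
    (hmaxY : ∀ (b : ℕ) (U : Type u) [Fintype U] (Z : SimpleGraph U), IsVertexTransitive Z →
      Nonempty (Y ≃g lex (completeG b) Z) → b ≤ β) :
    (Qut (lex X Y)).EqVia
      (freeWreath (freeWreath (Qut Y') (quantumSymmetric (Fin (α * β)))) (Qut X'))
      (regroup f.toEquiv g.toEquiv) := by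
  have : Nonempty W' := ‹Nonempty W›.map fun y => (g y).2
  have : Nonempty (Fin (α * β) × W') :=
    ⟨(⟨0, Nat.mul_pos (by omega) (by omega)⟩, Classical.arbitrary W')⟩
  have h1 := Qut_lex_eqVia_of_maximal hα hβ hX'.compl hY'.compl (complLexComplete f)
    (complCompleteLex g) (fun a U _ Z hZ h => hmaxX a U Zᶜ hZ.compl (lex_complete_of_compl h))
    (fun b U _ Z hZ h => hmaxY b U Zᶜ hZ.compl (complete_lex_of_compl h))
  have h0 := Qut_compl (lex X Y)
  rw [lex_compl] at h0
  have hS := universalQPG_generates (Fin (α * β)) ∅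
  have h2 := freeWreath_congr (Qut_generates _) (Qut_generates _) hS hS (Qut_compl Y')
    (⟨StarAlgEquiv.refl _ _, fun _ _ => rfl⟩)
  have h3 := freeWreath_congr (freeWreath_generates (Qut_generates Y'ᶜ) hS)
    (freeWreath_generates (Qut_generates Y') hS) (Qut_generates _) (Qut_generates _) h2
    (Qut_compl X')
  -- Passing to complements leaves all the vertex bijections unchanged, so the identification is
  -- still the given `regroup`.
  exact (h0.symm.trans (h1.trans h3)).of_eq (Equiv.ext fun _ => rfl)

end Maximal

end QuantumAut

end

theorem mainTheorem5 {V W : Type u} [Fintype V] [Fintype W] [Nonempty W]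
    (X : SimpleGraph V) (Y : SimpleGraph W)
    (hX : QuantumAut.IsVertexTransitive X) (hY : QuantumAut.IsVertexTransitive Y)
    (hne : ¬ (QuantumAut.Qut (QuantumAut.lex X Y)).Eq
      (QuantumAut.freeWreath (QuantumAut.Qut Y) (QuantumAut.Qut X))) :
    -- existence of the factorizations
    (∃ (α β : ℕ) (V' W' : Type u) (_ : Fintype V') (_ : Fintype W')
        (X' : SimpleGraph V') (Y' : SimpleGraph W'),
      1 < α ∧ 1 < β ∧
      QuantumAut.IsVertexTransitive X' ∧ QuantumAut.IsVertexTransitive Y' ∧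
      ((Nonempty (X ≃g QuantumAut.lex X' (QuantumAut.edgelessG α)) ∧
          Nonempty (Y ≃g QuantumAut.lex (QuantumAut.edgelessG β) Y')) ∨
        (Nonempty (X ≃g QuantumAut.lex X' (QuantumAut.completeG α)) ∧
          Nonempty (Y ≃g QuantumAut.lex (QuantumAut.completeG β) Y')))) ∧
    -- maximal factorizations of the first kind
    (∀ (α β : ℕ) (V' W' : Type u) [Fintype V'] [Fintype W']
        (X' : SimpleGraph V') (Y' : SimpleGraph W'),
      1 < α → 1 < β →
      QuantumAut.IsVertexTransitive X' → QuantumAut.IsVertexTransitive Y' →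
      ∀ (f : X ≃g QuantumAut.lex X' (QuantumAut.edgelessG α))
        (g : Y ≃g QuantumAut.lex (QuantumAut.edgelessG β) Y'),
      (∀ (a : ℕ) (U : Type u) [Fintype U] (Z : SimpleGraph U),
        QuantumAut.IsVertexTransitive Z →
        Nonempty (X ≃g QuantumAut.lex Z (QuantumAut.edgelessG a)) → a ≤ α) →
      (∀ (b : ℕ) (U : Type u) [Fintype U] (Z : SimpleGraph U),
        QuantumAut.IsVertexTransitive Z →
        Nonempty (Y ≃g QuantumAut.lex (QuantumAut.edgelessG b) Z) → b ≤ β) →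
      (QuantumAut.Qut (QuantumAut.lex X Y)).EqVia
        (QuantumAut.freeWreath
          (QuantumAut.freeWreath (QuantumAut.Qut Y')
            (QuantumAut.quantumSymmetric (Fin (α * β))))
          (QuantumAut.Qut X'))
        (QuantumAut.regroup f.toEquiv g.toEquiv)) ∧
    -- maximal factorizations of the second kind
    (∀ (α β : ℕ) (V' W' : Type u) [Fintype V'] [Fintype W']
        (X' : SimpleGraph V') (Y' : SimpleGraph W'),
      1 < α → 1 < β →
      QuantumAut.IsVertexTransitive X' → QuantumAut.IsVertexTransitive Y' →
      ∀ (f : X ≃g QuantumAut.lex X' (QuantumAut.completeG α))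
        (g : Y ≃g QuantumAut.lex (QuantumAut.completeG β) Y'),
      (∀ (a : ℕ) (U : Type u) [Fintype U] (Z : SimpleGraph U),
        QuantumAut.IsVertexTransitive Z →
        Nonempty (X ≃g QuantumAut.lex Z (QuantumAut.completeG a)) → a ≤ α) →
      (∀ (b : ℕ) (U : Type u) [Fintype U] (Z : SimpleGraph U),
        QuantumAut.IsVertexTransitive Z →
        Nonempty (Y ≃g QuantumAut.lex (QuantumAut.completeG b) Z) → b ≤ β) →
      (QuantumAut.Qut (QuantumAut.lex X Y)).EqVia
        (QuantumAut.freeWreath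
          (QuantumAut.freeWreath (QuantumAut.Qut Y')
            (QuantumAut.quantumSymmetric (Fin (α * β))))
          (QuantumAut.Qut X'))
        (QuantumAut.regroup f.toEquiv g.toEquiv)) := by
  refine ⟨?_, ?_, ?_⟩
  -- The two cases are the two ways in which the conditions of `Qut_lex` can fail; they lead to (a)
  -- and (b) respectively.
  · by_cases h1 : QuantumAut.HasTwins X ∧ ¬ Y.Preconnected
    · obtain ⟨α, V', _, X', hα, hX', f⟩ := QuantumAut.exists_lex_edgeless_of_hasTwins hX h1.1
      obtain ⟨β, W', _, Y', hβ, hY', g⟩ :=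
        QuantumAut.exists_edgeless_lex_of_not_preconnected hY h1.2
      exact ⟨α, β, V', W', ‹_›, ‹_›, X', Y', hα, hβ, hX', hY', Or.inl ⟨f, g⟩⟩
    by_cases h2 : QuantumAut.HasTwins Xᶜ ∧ ¬ Yᶜ.Preconnected
    · obtain ⟨α, V', _, X', hα, hX', f⟩ :=
        QuantumAut.exists_lex_edgeless_of_hasTwins hX.compl h2.1
      obtain ⟨β, W', _, Y', hβ, hY', g⟩ :=
        QuantumAut.exists_edgeless_lex_of_not_preconnected hY.compl h2.2
      exact ⟨α, β, V', W', ‹_›, ‹_›, X'ᶜ, Y'ᶜ, hα, hβ, hX'.compl, hY'.compl,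
        Or.inr ⟨QuantumAut.lex_complete_of_compl f, QuantumAut.complete_lex_of_compl g⟩⟩
    · exact absurd (QuantumAut.Qut_lex hX (by tauto) (by tauto)) hne
  · intro α β V' W' _ _ X' Y' hα hβ hX' hY' f g hmaxX hmaxY
    exact QuantumAut.Qut_lex_eqVia_of_maximal hα hβ hX' hY' f g hmaxX hmaxY
  · intro α β V' W' _ _ X' Y' hα hβ hX' hY' f g hmaxX hmaxY
    exact QuantumAut.Qut_lex_eqVia_of_maximal_complete hα hβ hX' hY' f g hmaxX hmaxY
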